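/- **Theorem (five-dimensional SNC-algebras with abelian derived algebra).** A real Lie algebra $\mathfrak g$ is called an SNC-algebra if it admits an inner product for which the corresponding left-invariant Riemannian metric has strictly negative sectional curvature. Let $\mathfrak g$ be an SNC-algebra of dimension five whose derived algebra $\mathfrak n=[\mathfrak g,\mathfrak g]$ is abelian. Then $\dim\mathfrak n=4$, and there exist a basis $e_1,e_2,e_3,e_4$ of $\mathfrak n$ and an element $e_5\in\mathfrak g\setminus\mathfrak n$ whose brackets are given by one of the following (with real parameters). 1. $[e_5,e_1]=x_1e_1,\ [e_5,e_2]=x_2e_2,\ [e_5,e_3]=x_3e_3,\ [e_5,e_4]=e_4$, where $0<x_1\le x_2\le x_3\le 1$. 2. $[e_5,e_1]=y_1e_1,\ [e_5,e_2]=y_2e_2,\ [e_5,e_3]=e_3,\ [e_5,e_4]=e_3+e_4$, where $0<y_1\le y_2$. 3. $[e_5,e_1]=y_1e_1,\ [e_5,e_2]=y_2e_2,\ [e_5,e_3]=e_3+\beta e_4,\ [e_5,e_4]=-\beta e_3+e_4$, where $0<y_1\le y_2$ and $0<\beta$. 4. $[e_5,e_1]=y_1e_1,\ [e_5,e_2]=e_2,\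 [e_5,e_3]=e_2+e_3,\ [e_5,e_4]=e_3+e_4$, where $0<y_1$. 5. $[e_5,e_1]=y_1e_1,\ [e_5,e_2]=e_1+y_1e_2,\ [e_5,e_3]=e_3,\ [e_5,e_4]=e_3+e_4$, where $0<y_1\le 1$. 6. $[e_5,e_1]=y_1e_1,\ [e_5,e_2]=e_1+y_1e_2,\ [e_5,e_3]=e_3+\beta e_4,\ [e_5,e_4]=-\beta e_3+e_4$, where $0<y_1$ and $0<\beta$. 7. $[e_5,e_1]=\alpha e_1+\beta e_2,\ [e_5,e_2]=-\beta e_1+\alpha e_2,\ [e_5,e_3]=e_3+\beta' e_4,\ [e_5,e_4]=-\beta' e_3+e_4$, where $0<\alpha\le 1$, $0<\beta$, $0<\beta'$, and $\beta\le\beta'$ if $\alpha=1$. 8. $[e_5,e_1]=e_1,\ [e_5,e_2]=e_1+e_2,\ [e_5,e_3]=e_2+e_3,\ [e_5,e_4]=e_3+e_4$. 9. $[e_5,e_1]=e_1+\beta e_2,\ [e_5,e_2]=-\beta e_1+e_2,\ [e_5,e_3]=e_1+e_3+\beta e_4,\ [e_5,e_4]=e_2-\beta e_3+e_4$, where $0<\beta$.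 Conversely, each item and each choice of its parameters in the stated range defines a five-dimensional Lie algebra with basis $e_1,\dots,e_5$, the listed brackets, and $[e_i,e_j]=0$ for $1\le i,j\le 4$. Any two of these Lie algebras that belong to different items, or to the same item with different parameters, are not isomorphic. -/

import Mathlib

/-- An inner product on a real vector space, as a bilinear form: symmetric and positive definite. -/
structure IsInnerProduct {V : Type*} [AddCommGroup V] [Module ℝ V]
    (B : LinearMap.BilinForm ℝ V) : Prop where
  symm : ∀ x y, B x y = B y x
  pos_def : ∀ x, x ≠ 0 → 0 < B x x

section Curvature

variable {g : Type*} [LieRing g] [LieAlgebra ℝ g]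

/-- `nabla X Y` is `∇_X Y` for left-invariant vector fields `X`, `Y` on a Lie group with Lie
algebra `g` and the left-invariant metric `B`, where `∇` is the Levi-Civita connection. Since `B`
is constant on left-invariant fields, metric compatibility reads `⟨∇_X Y, Z⟩ + ⟨Y, ∇_X Z⟩ = 0`.
For an inner product `B` on a finite-dimensional `g` there is exactly one such map. -/
structure IsLeviCivita (B : LinearMap.BilinForm ℝ g) (nabla : g →ₗ[ℝ] g →ₗ[ℝ] g) : Prop where
  torsion_free : ∀ X Y, nabla X Y - nabla Y X = ⁅X, Y⁆
  metric : ∀ X Y Z, B (nabla X Y) Z + B Y (nabla X Z) = 0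

/-- The curvature tensor `R(X, Y) Z = ∇_X ∇_Y Z - ∇_Y ∇_X Z - ∇_[X,Y] Z`. -/
def curvatureTensor (nabla : g →ₗ[ℝ] g →ₗ[ℝ] g) (X Y Z : g) : g :=
  nabla X (nabla Y Z) - nabla Y (nabla X Z) - nabla ⁅X, Y⁆ Z

/-- The sectional curvature of the plane spanned by (linearly independent) `X` and `Y`. -/
noncomputable def sectionalCurvature (B : LinearMap.BilinForm ℝ g)
    (nabla : g →ₗ[ℝ] g →ₗ[ℝ] g) (X Y : g) : ℝ :=
  B (curvatureTensor nabla X Y Y) X / (B X X * B Y Y - B X Y ^ 2)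

variable (g) in
/-- An SNC-algebra: a real Lie algebra which admits an inner product all of whose sectional
curvatures are strictly negative. -/
def IsSNC : Prop :=
  ∃ (B : LinearMap.BilinForm ℝ g) (nabla : g →ₗ[ℝ] g →ₗ[ℝ] g),
    IsInnerProduct B ∧ IsLeviCivita B nabla ∧
      ∀ X Y : g, LinearIndependent ℝ ![X, Y] → sectionalCurvature B nabla X Y < 0

end Curvature

/-- The derived algebra `[g, g]`. -/
abbrev derivedAlgebra (g : Type*) [LieRing g] [LieAlgebra ℝ g] : LieIdeal ℝ g :=
  ⁅(⊤ : LieIdeal ℝ g), (⊤ : LieIdeal ℝ g)⁆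

/-- The nine types of normal forms, with their real parameters. -/
inductive NormalForm : Type
  | type1 (x₁ x₂ x₃ : ℝ)
  | type2 (y₁ y₂ : ℝ)
  | type3 (y₁ y₂ β : ℝ)
  | type4 (y₁ : ℝ)
  | type5 (y₁ : ℝ)
  | type6 (y₁ β : ℝ)
  | type7 (α β β' : ℝ)
  | type8
  | type9 (β : ℝ)

namespace NormalForm

/-- The parameter ranges. -/
def Admissible : NormalForm → Prop
  | type1 x₁ x₂ x₃ => 0 < x₁ ∧ x₁ ≤ x₂ ∧ x₂ ≤ x₃ ∧ x₃ ≤ 1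
  | type2 y₁ y₂ => 0 < y₁ ∧ y₁ ≤ y₂
  | type3 y₁ y₂ β => 0 < y₁ ∧ y₁ ≤ y₂ ∧ 0 < β
  | type4 y₁ => 0 < y₁
  | type5 y₁ => 0 < y₁ ∧ y₁ ≤ 1
  | type6 y₁ β => 0 < y₁ ∧ 0 < β
  | type7 α β β' => 0 < α ∧ α ≤ 1 ∧ 0 < β ∧ 0 < β' ∧ (α = 1 → β ≤ β')
  | type8 => True
  | type9 β => 0 < β

/-- The matrix of `ad e₅` on `span (e₁, e₂, e₃, e₄)`: column `j` holds the coordinates of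
`[e₅, e_j]`. -/
def matrix : NormalForm → Matrix (Fin 4) (Fin 4) ℝ
  | type1 x₁ x₂ x₃ =>
    !![x₁, 0, 0, 0;
       0, x₂, 0, 0;
       0, 0, x₃, 0;
       0, 0, 0, 1]
  | type2 y₁ y₂ =>
    !![y₁, 0, 0, 0;
       0, y₂, 0, 0;
       0, 0, 1, 1;
       0, 0, 0, 1]
  | type3 y₁ y₂ β =>
    !![y₁, 0, 0, 0;
       0, y₂, 0, 0;
       0, 0, 1, -β;
       0, 0, β, 1]
  | type4 y₁ =>
    !![y₁, 0, 0, 0;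
       0, 1, 1, 0;
       0, 0, 1, 1;
       0, 0, 0, 1]
  | type5 y₁ =>
    !![y₁, 1, 0, 0;
       0, y₁, 0, 0;
       0, 0, 1, 1;
       0, 0, 0, 1]
  | type6 y₁ β =>
    !![y₁, 1, 0, 0;
       0, y₁, 0, 0;
       0, 0, 1, -β;
       0, 0, β, 1]
  | type7 α β β' =>
    !![α, -β, 0, 0;
       β, α, 0, 0;
       0, 0, 1, -β';
       0, 0, β', 1]
  | type8 =>
    !![1, 1, 0, 0;
       0, 1, 1, 0;
       0, 0, 1, 1;
       0, 0, 0, 1]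
  | type9 β =>
    !![1, -β, 1, 0;
       β, 1, 0, 1;
       0, 0, 1, -β;
       0, 0, β, 1]

end NormalForm

/-- The expanded Lie algebra `ℝ⁴ ⊕ ℝ e₅` of the abelian Lie algebra `ℝ⁴` by the matrix `M`:
`ℝ⁴` is abelian and `[e₅, v] = M v` for `v` in `ℝ⁴`. The pair `(v, s)` stands for `v + s e₅`. -/
def ExpandedAlgebra (_M : Matrix (Fin 4) (Fin 4) ℝ) : Type := (Fin 4 → ℝ) × ℝ

namespace ExpandedAlgebra

variable (M : Matrix (Fin 4) (Fin 4) ℝ)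

noncomputable instance : AddCommGroup (ExpandedAlgebra M) :=
  inferInstanceAs (AddCommGroup ((Fin 4 → ℝ) × ℝ))

noncomputable instance : Module ℝ (ExpandedAlgebra M) :=
  inferInstanceAs (Module ℝ ((Fin 4 → ℝ) × ℝ))

variable {M}

/-- `[v + s e₅, w + t e₅] = s M w - t M v`. -/
noncomputable instance : Bracket (ExpandedAlgebra M) (ExpandedAlgebra M) :=
  ⟨fun a b => (a.2 • M.mulVec b.1 - b.2 • M.mulVec a.1, (0 : ℝ))⟩

theorem ext {a b : ExpandedAlgebra M} (h₁ : a.1 = b.1) (h₂ : a.2 = b.2) : a = b :=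
  Prod.ext h₁ h₂

theorem add_fst (a b : ExpandedAlgebra M) : (a + b).1 = a.1 + b.1 := rfl

theorem add_snd (a b : ExpandedAlgebra M) : (a + b).2 = a.2 + b.2 := rfl

theorem smul_fst (c : ℝ) (a : ExpandedAlgebra M) : (c • a).1 = c • a.1 := rfl

theorem smul_snd (c : ℝ) (a : ExpandedAlgebra M) : (c • a).2 = c * a.2 := rfl

theorem zero_fst : (0 : ExpandedAlgebra M).1 = 0 := rfl

theorem zero_snd : (0 : ExpandedAlgebra M).2 = 0 := rfl

theorem bracket_fst (a b : ExpandedAlgebra M) :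
    (⁅a, b⁆).1 = a.2 • M.mulVec b.1 - b.2 • M.mulVec a.1 := rfl

theorem bracket_snd (a b : ExpandedAlgebra M) : (⁅a, b⁆).2 = 0 := rfl

noncomputable instance : LieRing (ExpandedAlgebra M) where
  add_lie a b c := by
    apply ext
    · simp only [add_fst, add_snd, bracket_fst, Matrix.mulVec_add]
      module
    · simp only [add_snd, bracket_snd, add_zero]
  lie_add a b c := by
    apply ext
    · simp only [add_fst, add_snd, bracket_fst, Matrix.mulVec_add]
      module
    · simp only [add_snd, bracket_snd, add_zero]
  lie_self a := by
    apply ext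
    · simp only [bracket_fst, sub_self, zero_fst]
    · simp only [bracket_snd, zero_snd]
  leibniz_lie a b c := by
    apply ext
    · simp only [add_fst, bracket_fst, bracket_snd, Matrix.mulVec_sub, Matrix.mulVec_smul]
      module
    · simp only [add_snd, bracket_snd, add_zero]

noncomputable instance : LieAlgebra ℝ (ExpandedAlgebra M) where
  lie_smul c a b := by
    apply ext
    · simp only [smul_fst, smul_snd, bracket_fst, Matrix.mulVec_smul]
      module
    · simp only [smul_snd, bracket_snd, mul_zero]

end ExpandedAlgebra

/-! For commuting `X`, `Y` the curvature numerator is `|∇_X Y|² - ⟨∇_X X, ∇_Y Y⟩`, so negative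
curvature forces `⟨∇_X X, ∇_Y Y⟩ > 0` whenever `X`, `Y` are independent. Let `A ≠ 0` be orthogonal
to the derived algebra `n`. Then `∇_A A = 0`, so `A` commutes only with its multiples. Hence `ad A`
has rank at least `dim g - 1`, and its image lies in the proper ideal `n`: the codimension of `n` is
one. For `X` in the abelian ideal `n`, `∇_X X` is the multiple of `A` with coefficient `⟨[A, X], X⟩
/ |A|²`. The inequality therefore says that the quadratic form `⟨[A, X], X⟩` has one strict sign on
`n`, and replacing `A` by `-A` if needed makes it positive (`IsSNC.exists_positive`).

The brackets are then encoded by `D = ad A` on the four-dimensional `n`. The structure theorem over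
`ℝ[X]` gives a real Jordan form (`exists_hasMatrix_four`), positivity of the form makes the real
parts of all eigenvalues positive, and rescaling `A` and permuting blocks gives the nine types
(`exists_normalForm`).

For uniqueness, an isomorphism preserves the derived algebra `ℝ⁴`, so it makes the two matrices
similar up to a nonzero real factor `c` (`ExpandedAlgebra.exists_similar_of_equiv`). Kernels of
powers `(T - z)^k` determine the multiset of pairs (eigenvalue, height in its Jordan chain), up to
scaling eigenvalues by `c` (`jordanMultiset_smul`). Heights and reality of eigenvalues determine the
type. The normalized eigenvalues force `c = 1`, and the ordering conventions then recover the
parameters (`NormalForm.eq_of_jordan_eq_smul`). -/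

/-! ### Algebraic consequences of negative curvature -/

section NegativeCurvature

open Module

variable {g : Type*} [LieRing g] [LieAlgebra ℝ g] {B : LinearMap.BilinForm ℝ g}
  {nabla : g →ₗ[ℝ] g →ₗ[ℝ] g}

/-- Cauchy–Schwarz: the squared length of `B X X • Y - B X Y • X` is `B X X` times this Gram
determinant. -/
theorem IsInnerProduct.gram_nonneg (hB : IsInnerProduct B) (X Y : g) :
    0 ≤ B X X * B Y Y - B X Y ^ 2 := by
  have hnn : ∀ Z, 0 ≤ B Z Z := fun Z => by
    by_cases hZ : Z = 0
    · simp [hZ]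
    · exact (hB.pos_def Z hZ).le
  by_cases hX : X = 0
  · simp [hX]
  have hXX := hB.pos_def X hX
  have h := hnn (B X X • Y - B X Y • X)
  simp only [map_sub, map_smul, LinearMap.sub_apply, LinearMap.smul_apply, smul_eq_mul,
    hB.symm Y X] at h
  have h' : 0 ≤ B X X * (B X X * B Y Y - B X Y ^ 2) := by linarith
  exact nonneg_of_mul_nonneg_right h' hXX

/-- A case of Koszul's formula: metric compatibility moves `∇_X` to `Z`, and `∇_Z X` is orthogonal
to `X`. -/
theorem IsLeviCivita.apply_self (hB : IsInnerProduct B) (hn : IsLeviCivita B nabla) (X Z : g) :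
    B (nabla X X) Z = B X ⁅Z, X⁆ := by
  have h₁ := hn.metric X X Z
  have h₂ := hn.metric Z X X
  have h₃ := hn.torsion_free Z X
  rw [hB.symm (nabla Z X) X] at h₂
  rw [← h₃, map_sub]
  linarith

/-- Commutation removes the `∇_[X,Y]` term and gives `∇_Y X = ∇_X Y`; the outer derivatives are then
moved across `B` by skew-symmetry. -/
theorem IsLeviCivita.curvature_of_commute (hB : IsInnerProduct B) (hn : IsLeviCivita B nabla)
    {X Y : g} (h : ⁅X, Y⁆ = 0) :
    B (curvatureTensor nabla X Y Y) X =
      B (nabla X Y) (nabla X Y) - B (nabla X X) (nabla Y Y) := by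
  have hXY : nabla Y X = nabla X Y := (sub_eq_zero.1 ((hn.torsion_free X Y).trans h)).symm
  have h₁ := hn.metric X (nabla Y Y) X
  have h₂ := hn.metric Y (nabla X Y) X
  rw [hXY] at h₂
  rw [hB.symm] at h₁
  simp only [curvatureTensor, h, map_sub, map_zero, LinearMap.zero_apply, LinearMap.sub_apply,
    sub_zero]
  rw [hB.symm (nabla X (nabla Y Y)) X, hB.symm (nabla X X) (nabla Y Y)]
  linarith

/-- In negative curvature, the vectors `∇_X X` and `∇_Y Y` of independent commuting `X`, `Y`
have positive inner product. -/
theorem IsLeviCivita.inner_pos_of_commute (hB : IsInnerProduct B) (hn : IsLeviCivita B nabla)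
    (hneg : ∀ X Y : g, LinearIndependent ℝ ![X, Y] → sectionalCurvature B nabla X Y < 0)
    {X Y : g} (hli : LinearIndependent ℝ ![X, Y]) (h : ⁅X, Y⁆ = 0) :
    0 < B (nabla X X) (nabla Y Y) := by
  have hK := hneg X Y hli
  have hnum : B (curvatureTensor nabla X Y Y) X < 0 := by
    by_contra! hge
    exact absurd (div_nonneg hge (hB.gram_nonneg X Y)) (not_le.2 hK)
  rw [hn.curvature_of_commute hB h] at hnum
  have hnn : 0 ≤ B (nabla X Y) (nabla X Y) := by
    by_cases hZ : nabla X Y = 0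
    · simp [hZ]
    · exact (hB.pos_def _ hZ).le
  linarith

theorem lie_mem_derivedAlgebra (X Y : g) : ⁅X, Y⁆ ∈ derivedAlgebra g :=
  LieSubmodule.lie_mem_lie (LieSubmodule.mem_top X) (LieSubmodule.mem_top Y)

theorem derivedAlgebra_ne_top [Nontrivial g] (hab : IsLieAbelian (derivedAlgebra g)) :
    derivedAlgebra g ≠ ⊤ := by
  intro htop
  have hmem : ∀ X : g, X ∈ derivedAlgebra g := fun X => htop ▸ LieSubmodule.mem_top X
  have hcomm : ∀ X Y : g, ⁅X, Y⁆ = 0 := fun X Y => by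
    have := hab.trivial ⟨X, hmem X⟩ ⟨Y, hmem Y⟩
    exact congrArg Subtype.val this
  have hbot : derivedAlgebra g = ⊥ := by
    rw [LieSubmodule.lie_eq_bot_iff]
    intro X _ Y _
    exact hcomm X Y
  have : (⊥ : LieIdeal ℝ g) ≠ ⊤ := bot_ne_top
  exact this (hbot.symm.trans htop)

/-- In negative curvature, a vector orthogonal to the derived algebra commutes only with its
multiples. -/
theorem IsLeviCivita.mem_span_of_commute (hB : IsInnerProduct B) (hn : IsLeviCivita B nabla)
    (hneg : ∀ X Y : g, LinearIndependent ℝ ![X, Y] → sectionalCurvature B nabla X Y < 0)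
    {A Y : g} (hA : A ≠ 0) (hAn : ∀ Z ∈ derivedAlgebra g, B A Z = 0) (h : ⁅A, Y⁆ = 0) :
    Y ∈ ℝ ∙ A := by
  have hAA : nabla A A = 0 := by
    by_contra hne
    have := hB.pos_def _ hne
    rw [hn.apply_self hB, hAn _ (lie_mem_derivedAlgebra _ _)] at this
    exact lt_irrefl _ this
  by_contra hY
  have hli : LinearIndependent ℝ ![A, Y] := by
    rw [LinearIndependent.pair_iff' hA]
    intro a ha
    exact hY (Submodule.mem_span_singleton.2 ⟨a, ha⟩)
  have := hn.inner_pos_of_commute hB hneg hli h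
  simp [hAA] at this

/-- A dimension count: the map from `g` to the dual of `N` induced by `B` cannot be injective. -/
theorem IsInnerProduct.exists_orthogonal_ne_zero [FiniteDimensional ℝ g]
    {N : Submodule ℝ g} (hN : N ≠ ⊤) : ∃ A : g, A ≠ 0 ∧ ∀ Z ∈ N, B A Z = 0 := by
  let f : g →ₗ[ℝ] Dual ℝ N := N.subtype.dualMap ∘ₗ B
  have hf : LinearMap.ker f ≠ ⊥ := by
    apply LinearMap.ker_ne_bot_of_finrank_lt
    rw [Subspace.dual_finrank_eq]
    exact Submodule.finrank_lt hN
  obtain ⟨A, hA, hA0⟩ := Submodule.exists_mem_ne_zero_of_ne_bot hf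
  exact ⟨A, hA0, fun Z hZ => LinearMap.congr_fun (LinearMap.mem_ker.1 hA) ⟨Z, hZ⟩⟩

/-- The algebraic consequences of negative curvature used for the classification: the derived
algebra has codimension one, and some element outside acts on it with positive definite
symmetric part. -/
theorem IsSNC.exists_positive [FiniteDimensional ℝ g] (hg : IsSNC g) (hdim : 3 ≤ finrank ℝ g)
    (hab : IsLieAbelian (derivedAlgebra g)) :
    finrank ℝ (derivedAlgebra g) + 1 = finrank ℝ g ∧
      ∃ (A : g) (B : LinearMap.BilinForm ℝ g), A ∉ derivedAlgebra g ∧ IsInnerProduct B ∧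
        ∀ X ∈ derivedAlgebra g, X ≠ 0 → 0 < B ⁅A, X⁆ X := by
  obtain ⟨B, nabla, hB, hn, hneg⟩ := hg
  have : Nontrivial g := nontrivial_of_finrank_pos (R := ℝ) (by omega)
  have hNtop : (derivedAlgebra g).toSubmodule ≠ ⊤ := fun h =>
    derivedAlgebra_ne_top hab ((LieSubmodule.toSubmodule_eq_top _).1 h)
  obtain ⟨A, hA0, hAn⟩ := IsInnerProduct.exists_orthogonal_ne_zero (B := B) hNtop
  replace hAn : ∀ Z ∈ derivedAlgebra g, B A Z = 0 := hAn
  have hAA := hB.pos_def A hA0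
  have hAmem : A ∉ derivedAlgebra g := fun h => by
    rw [hAn A h] at hAA
    exact lt_irrefl _ hAA
  -- Rank–nullity for `ad A`: its kernel lies in the line of `A`, its range in the derived algebra.
  have hcod : finrank ℝ (derivedAlgebra g) + 1 = finrank ℝ g := by
    have h₁ : finrank ℝ (derivedAlgebra g).toSubmodule < finrank ℝ g :=
      Submodule.finrank_lt hNtop
    have h₂ : finrank ℝ (LinearMap.ker (LieAlgebra.ad ℝ g A : g →ₗ[ℝ] g)) ≤ 1 := by
      refine (Submodule.finrank_mono (t := ℝ ∙ A) fun Y hY => ?_).trans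
        (finrank_span_singleton hA0).le
      exact hn.mem_span_of_commute hB hneg hA0 hAn (LinearMap.mem_ker.1 hY)
    have h₃ : finrank ℝ (LinearMap.range (LieAlgebra.ad ℝ g A : g →ₗ[ℝ] g)) ≤
        finrank ℝ (derivedAlgebra g).toSubmodule := by
      refine Submodule.finrank_mono ?_
      rintro _ ⟨Y, rfl⟩
      exact lie_mem_derivedAlgebra A Y
    have h₄ := LinearMap.finrank_range_add_finrank_ker (LieAlgebra.ad ℝ g A : g →ₗ[ℝ] g)
    have h₅ : finrank ℝ (derivedAlgebra g) = finrank ℝ (derivedAlgebra g).toSubmodule := rfl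
    omega
  refine ⟨hcod, ?_⟩
  have hsup : (derivedAlgebra g).toSubmodule ⊔ ℝ ∙ A = ⊤ := by
    apply Submodule.eq_top_of_finrank_eq
    have hlt : (derivedAlgebra g).toSubmodule < (derivedAlgebra g).toSubmodule ⊔ ℝ ∙ A := by
      refine lt_of_le_of_ne le_sup_left fun h => hAmem ?_
      have : A ∈ (derivedAlgebra g).toSubmodule ⊔ ℝ ∙ A :=
        Submodule.mem_sup_right (Submodule.mem_span_singleton_self A)
      rw [← h] at this
      exact this
    have h₁ := Submodule.finrank_lt_finrank_of_lt hlt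
    have h₂ := Submodule.finrank_le ((derivedAlgebra g).toSubmodule ⊔ ℝ ∙ A)
    have h₅ : finrank ℝ (derivedAlgebra g) = finrank ℝ (derivedAlgebra g).toSubmodule := rfl
    omega
  have hcomm : ∀ X ∈ derivedAlgebra g, ∀ Y ∈ derivedAlgebra g, ⁅X, Y⁆ = 0 :=
    fun X hX Y hY => congrArg Subtype.val (hab.trivial ⟨X, hX⟩ ⟨Y, hY⟩)
  -- The component of `∇_X X` in the derived algebra vanishes: for `m` there, `B (∇_X X) m = B X [m,
  -- X] = 0`.
  have hnab : ∀ X ∈ derivedAlgebra g, ∃ s : ℝ, nabla X X = s • A ∧ B ⁅A, X⁆ X = s * B A A := by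
    intro X hX
    obtain ⟨m, hm, a, ha, hma⟩ := Submodule.mem_sup.1 (hsup ▸ Submodule.mem_top (x := nabla X X))
    obtain ⟨s, rfl⟩ := Submodule.mem_span_singleton.1 ha
    have hm0 : m = 0 := by
      by_contra hne
      have h₁ := hB.pos_def m hne
      have h₂ := hn.apply_self hB X m
      rw [hcomm m hm X hX, ← hma] at h₂
      simp only [map_add, map_smul, LinearMap.add_apply, LinearMap.smul_apply, smul_eq_mul,
        hAn m hm, map_zero] at h₂
      linarith
    have hs : nabla X X = s • A := by rw [← hma, hm0, zero_add]
    refine ⟨s, hs, ?_⟩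
    rw [hB.symm, ← hn.apply_self hB, hs]
    simp
  have hpair : ∀ X ∈ derivedAlgebra g, ∀ Y ∈ derivedAlgebra g, LinearIndependent ℝ ![X, Y] →
      0 < B ⁅A, X⁆ X * B ⁅A, Y⁆ Y := by
    intro X hX Y hY hli
    obtain ⟨s, hs, hs'⟩ := hnab X hX
    obtain ⟨t, ht, ht'⟩ := hnab Y hY
    have := hn.inner_pos_of_commute hB hneg hli (hcomm X hX Y hY)
    rw [hs, ht] at this
    simp only [map_smul, LinearMap.smul_apply, smul_eq_mul] at this
    rw [hs', ht']
    have h2 := mul_pos this hAA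
    nlinarith
  obtain ⟨X₀, hX₀⟩ : ∃ X₀ : derivedAlgebra g, X₀ ≠ 0 :=
    haveI : Nontrivial (derivedAlgebra g) := nontrivial_of_finrank_pos (R := ℝ) (by omega)
    exists_ne 0
  have hX₀' : (X₀ : g) ≠ 0 := fun h => hX₀ (Subtype.ext h)
  have hsame : ∀ Y ∈ derivedAlgebra g, Y ≠ 0 → 0 < B ⁅A, (X₀ : g)⁆ X₀ * B ⁅A, Y⁆ Y := by
    -- The derived algebra has dimension at least two, so `X₀` has an independent partner; their
    -- positive product shows that the form does not vanish at `X₀`.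
    have hX₀pos : 0 < B ⁅A, (X₀ : g)⁆ X₀ * B ⁅A, (X₀ : g)⁆ X₀ := by
      have : ∃ Y : derivedAlgebra g, Y ∉ ℝ ∙ X₀ := by
        by_contra! hall
        have h₁ : (ℝ ∙ X₀ : Submodule ℝ (derivedAlgebra g)) = ⊤ :=
          Submodule.eq_top_iff'.2 hall
        have h₂ := finrank_span_singleton (K := ℝ) hX₀
        rw [h₁, finrank_top] at h₂
        omega
      obtain ⟨Y, hY⟩ := this
      have := hpair X₀ X₀.2 Y Y.2 ((LinearIndependent.pair_iff' hX₀').2 fun a ha =>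
        hY (Submodule.mem_span_singleton.2 ⟨a, Subtype.ext ha⟩))
      exact mul_self_pos.2 (left_ne_zero_of_mul this.ne')
    intro Y hY hY0
    by_cases hYs : ∃ a : ℝ, a • (X₀ : g) = Y
    · obtain ⟨a, rfl⟩ := hYs
      have ha : a ≠ 0 := by
        rintro rfl
        simp at hY0
      have : 0 < a ^ 2 := by positivity
      simp only [lie_smul, map_smul, LinearMap.smul_apply, smul_eq_mul]
      nlinarith [mul_pos this hX₀pos]
    · push Not at hYs
      exact hpair X₀ X₀.2 Y hY ((LinearIndependent.pair_iff' hX₀').2 hYs)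
  rcases lt_trichotomy (B ⁅A, (X₀ : g)⁆ X₀) 0 with h | h | h
  · refine ⟨-A, B, fun hmem => hAmem (by simpa using neg_mem hmem), hB, fun Y hY hY0 => ?_⟩
    have := hsame Y hY hY0
    simp only [neg_lie, map_neg, LinearMap.neg_apply]
    nlinarith [neg_of_mul_pos_right this h.le]
  · have := hsame X₀ X₀.2 hX₀'
    simp [h] at this
  · exact ⟨A, B, hAmem, hB, fun Y hY hY0 => pos_of_mul_pos_right (hsame Y hY hY0) h.le⟩

end NegativeCurvature

/-! ### Matrices of an endomorphism and change of basis -/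

section MatrixOfEndomorphism

open Module Matrix

variable {K V U : Type*} [Field K] [AddCommGroup V] [Module K V] [AddCommGroup U] [Module K U]
variable {n m : Type*} [Fintype n] [Fintype m]

/-- The endomorphism `D` has matrix `M` in some basis. -/
def HasMatrix (D : V →ₗ[K] V) (M : Matrix n n K) : Prop :=
  ∃ b : Basis n K V, ∀ j, D (b j) = ∑ i, M i j • b i

theorem HasMatrix.smul {D : V →ₗ[K] V} {M : Matrix n n K} (h : HasMatrix D M) (c : K) :
    HasMatrix (c • D) (c • M) := by
  obtain ⟨b, hb⟩ := h
  refine ⟨b, fun j => ?_⟩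
  simp [hb, Finset.smul_sum, mul_smul]

theorem HasMatrix.reindex {D : V →ₗ[K] V} {M : Matrix n n K} (h : HasMatrix D M) (e : n ≃ m)
    {M' : Matrix m m K} (hM : ∀ i j, M' (e i) (e j) = M i j) : HasMatrix D M' := by
  obtain ⟨b, hb⟩ := h
  refine ⟨b.reindex e, fun j => ?_⟩
  obtain ⟨j, rfl⟩ := e.surjective j
  rw [← e.sum_comp]
  simp [hb, hM]

/-- The columns of `P` are the coordinates of the new basis in the old one. -/
theorem HasMatrix.conj [DecidableEq n] {D : V →ₗ[K] V} {M M' : Matrix n n K}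
    (h : HasMatrix D M) (P : Matrix n n K) (hP : P.det ≠ 0) (hM : M * P = P * M') :
    HasMatrix D M' := by
  obtain ⟨b, hb⟩ := h
  refine ⟨b.map (Matrix.toLinearEquiv b P (isUnit_iff_ne_zero.2 hP)), fun j => ?_⟩
  have hexp : ∀ j, b.map (Matrix.toLinearEquiv b P (isUnit_iff_ne_zero.2 hP)) j =
      ∑ i, P i j • b i := fun j => by
    rw [Basis.map_apply]
    exact Matrix.toLin_self b b P j
  simp only [hexp, map_sum, map_smul, hb, Finset.smul_sum, smul_smul]
  rw [Finset.sum_comm, Finset.sum_comm (f := fun i k => (M' i j * P k i) • b k)]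
  refine Finset.sum_congr rfl fun k _ => ?_
  rw [← Finset.sum_smul, ← Finset.sum_smul]
  congr 1
  have := congrFun (congrFun hM k) j
  simp only [Matrix.mul_apply] at this
  simpa only [mul_comm] using this

theorem HasMatrix.card_eq_finrank {D : V →ₗ[K] V} {M : Matrix n n K} (h : HasMatrix D M) :
    finrank K V = Fintype.card n := by
  obtain ⟨b, -⟩ := h
  exact finrank_eq_card_basis b

/-- Splitting off an invariant direct summand with an invariant complement. -/
theorem HasMatrix.fromBlocks_of_split {D : V →ₗ[K] V} {E : U →ₗ[K] U} {π : V →ₗ[K] U}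
    {s : U →ₗ[K] V} (hπs : ∀ u, π (s u) = u) (hs : ∀ u, D (s u) = s (E u))
    (hW : ∀ w ∈ LinearMap.ker π, D w ∈ LinearMap.ker π) {A : Matrix n n K} {C : Matrix m m K}
    (hA : HasMatrix E A) (hC : HasMatrix (D.restrict hW) C) :
    HasMatrix D (fromBlocks A 0 0 C) := by
  obtain ⟨b, hb⟩ := hA
  obtain ⟨c, hc⟩ := hC
  let f : (U × LinearMap.ker π) →ₗ[K] V := s.coprod (LinearMap.ker π).subtype
  have hf : Function.Bijective f := by
    constructor
    · rw [← LinearMap.ker_eq_bot, LinearMap.ker_eq_bot']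
      rintro ⟨u, w, hw⟩ h
      have h' : s u + w = 0 := by simpa [f] using h
      have hu : u = 0 := by
        have := congrArg π h'
        rw [map_add, hπs, LinearMap.mem_ker.1 hw] at this
        simpa using this
      subst hu
      simp at h'
      simp [h']
    · intro v
      refine ⟨(π v, ⟨v - s (π v), by simp [hπs]⟩), ?_⟩
      simp [f]
  have hDc : ∀ j, D (c j : V) = ∑ i, C i j • (c i : V) := fun j => by
    have := congrArg Subtype.val (hc j)
    simpa using this
  refine ⟨(b.prod c).map (LinearEquiv.ofBijective f hf), fun j => ?_⟩
  rcases j with j | j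
  · simp [f, hs, hb]
  · simp [f, hDc]

end MatrixOfEndomorphism

/-! ### Splitting off a primary cyclic summand -/

section CyclicSummand

open Module Matrix Polynomial

variable {K V : Type*} [Field K] [AddCommGroup V] [Module K V]

/-- The companion matrix of a monic polynomial of degree `n`. -/
def companion (q : K[X]) (n : ℕ) : Matrix (Fin n) (Fin n) K :=
  Matrix.of fun i j => if (j : ℕ) + 1 = n then -q.coeff i else if (i : ℕ) = j + 1 then 1 else 0

theorem hasMatrix_companion {q : K[X]} (hq : q.Monic) (n : ℕ) (hn : q.natDegree = n)
    (hn0 : n ≠ 0) :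
    HasMatrix (LinearMap.mulLeft K (AdjoinRoot.root q)) (companion q n) := by
  subst hn
  have hq1 : q.degree ≠ 0 := fun h => hn0 (natDegree_eq_of_degree_eq_some h)
  have : Nontrivial (AdjoinRoot q) := AdjoinRoot.nontrivial q hq1
  have h := (AdjoinRoot.powerBasis' hq).leftMulMatrix
  have hmin : (AdjoinRoot.powerBasis' hq).minpolyGen = q := by
    rw [PowerBasis.minpolyGen_eq, AdjoinRoot.powerBasis'_gen]
    exact AdjoinRoot.minpoly_powerBasis_gen_of_monic hq
  rw [hmin] at h
  refine ⟨(AdjoinRoot.powerBasis' hq).basis, fun j => ?_⟩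
  refine Eq.trans ?_ (Matrix.toLin_self (AdjoinRoot.powerBasis' hq).basis
    (AdjoinRoot.powerBasis' hq).basis (companion q q.natDegree) j)
  have h3 : companion q q.natDegree = Algebra.leftMulMatrix (AdjoinRoot.powerBasis' hq).basis
    (AdjoinRoot.powerBasis' hq).gen := h.symm
  refine Eq.trans ?_ (congrArg (fun M => Matrix.toLin (AdjoinRoot.powerBasis' hq).basis
    (AdjoinRoot.powerBasis' hq).basis M ((AdjoinRoot.powerBasis' hq).basis j)) h3.symm)
  simp only [Algebra.leftMulMatrix_apply, Matrix.toLin_toMatrix]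
  rfl

/-- `V` is a torsion `K[X]`-module with `X` acting as `D`, hence a direct sum of modules `K[X] / (p
i ^ e i)`. The maps `π` and `s` are the projection to one nonzero summand and its inclusion; they
are `K[X]`-linear, so they respect `D`. -/
theorem exists_cyclic_split [FiniteDimensional K V] [Nontrivial V] (D : V →ₗ[K] V) :
    ∃ (p : K[X]) (e : ℕ) (π : V →ₗ[K] AdjoinRoot (p ^ e)) (s : AdjoinRoot (p ^ e) →ₗ[K] V),
      Irreducible p ∧ p.Monic ∧ e ≠ 0 ∧ (∀ u, π (s u) = u) ∧
      (∀ u, D (s u) = s (LinearMap.mulLeft K (AdjoinRoot.root (p ^ e)) u)) ∧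
      ∀ w ∈ LinearMap.ker π, D w ∈ LinearMap.ker π := by
  classical
  obtain ⟨ι, _, p, hp, e, ⟨φ⟩⟩ :=
    Module.equiv_directSum_of_isTorsion (Module.AEval.isTorsion_of_finiteDimensional K V D)
  obtain ⟨i, hi⟩ : ∃ i, e i ≠ 0 := by
    by_contra! h
    have hsub : ∀ i, Subsingleton (K[X] ⧸ K[X] ∙ p i ^ e i) := fun i => by
      rw [h i, pow_zero]
      exact Submodule.Quotient.subsingleton_iff.2 Ideal.span_singleton_one
    have : Subsingleton (AEval K V D) := φ.toEquiv.subsingleton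
    have : Subsingleton V := (AEval.of K V D).toEquiv.subsingleton
    exact not_subsingleton V this
  -- The structure theorem gives irreducible but not necessarily monic polynomials; the unit `C u`
  -- makes `p i` monic without changing the ideal.
  let u : K := (p i).leadingCoeff⁻¹
  have hu : u ≠ 0 := inv_ne_zero (leadingCoeff_ne_zero.2 (hp i).ne_zero)
  have hassoc : Associated (p i) (p i * C u) :=
    (associated_mul_unit_right _ _ (isUnit_C.2 (isUnit_iff_ne_zero.2 hu)))
  have hspan : (K[X] ∙ p i ^ e i) = Ideal.span {(p i * C u) ^ e i} :=
    Ideal.span_singleton_eq_span_singleton.2 (hassoc.pow_pow)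
  let : Algebra K[X] (AdjoinRoot ((p i * C u) ^ e i)) :=
    Ideal.Quotient.algebra K[X] (I := Ideal.span {(p i * C u) ^ e i})
  have : IsScalarTower K K[X] (AdjoinRoot ((p i * C u) ^ e i)) :=
    inferInstanceAs (IsScalarTower K K[X] (K[X] ⧸ Ideal.span {(p i * C u) ^ e i}))
  let ψ : (K[X] ⧸ K[X] ∙ p i ^ e i) ≃ₗ[K[X]] AdjoinRoot ((p i * C u) ^ e i) :=
    Submodule.quotEquivOfEq _ _ hspan
  let π : AEval K V D →ₗ[K[X]] AdjoinRoot ((p i * C u) ^ e i) :=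
    ψ.toLinearMap ∘ₗ DirectSum.component K[X] ι _ i ∘ₗ φ.toLinearMap
  let s : AdjoinRoot ((p i * C u) ^ e i) →ₗ[K[X]] AEval K V D :=
    φ.symm.toLinearMap ∘ₗ DirectSum.lof K[X] ι (fun i => K[X] ⧸ K[X] ∙ p i ^ e i) i ∘ₗ
      ψ.symm.toLinearMap
  refine ⟨p i * C u, e i, π.restrictScalars K ∘ₗ (AEval.of K V D).toLinearMap,
    (AEval.of K V D).symm.toLinearMap ∘ₗ s.restrictScalars K, hassoc.irreducible (hp i),
    monic_mul_leadingCoeff_inv (hp i).ne_zero, hi, fun x => ?_, fun x => ?_, fun w hw => ?_⟩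
  · simp [π, s, DirectSum.component.lof_self]
  · apply (AEval.of K V D).injective
    have h1 : LinearMap.mulLeft K (AdjoinRoot.root ((p i * C u) ^ e i)) x = (X : K[X]) • x := by
      rw [LinearMap.mulLeft_apply, Algebra.smul_def, ← AdjoinRoot.mk_X]
      rfl
    rw [h1]
    have h2 := AEval.X_smul_of (R := K) D ((AEval.of K V D).symm (s x))
    simp only [LinearMap.comp_apply, LinearMap.restrictScalars_apply, LinearEquiv.coe_coe,
      LinearEquiv.apply_symm_apply, map_smul] at h2 ⊢
    exact h2.symm
  · have h2 := AEval.X_smul_of (R := K) D w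
    simp only [LinearMap.mem_ker, LinearMap.comp_apply, LinearMap.restrictScalars_apply,
      LinearEquiv.coe_coe] at hw ⊢
    have h3 : AEval.of K V D (D w) = (X : K[X]) • AEval.of K V D w := h2.symm
    rw [h3, map_smul, hw, smul_zero]

/-- An endomorphism of a nonzero space splits off a cyclic summand, given by a companion matrix. -/
theorem exists_companion_split [FiniteDimensional K V] [Nontrivial V] (D : V →ₗ[K] V) :
    ∃ (p : K[X]) (e : ℕ), Irreducible p ∧ p.Monic ∧ e ≠ 0 ∧
      ∃ (W : Submodule K V) (hW : ∀ w ∈ W, D w ∈ W),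
        finrank K W + p.natDegree * e = finrank K V ∧
        ∀ (m n : ℕ) (A : Matrix (Fin n) (Fin n) K) (C : Matrix (Fin m) (Fin m) K),
          (∀ E : AdjoinRoot (p ^ e) →ₗ[K] AdjoinRoot (p ^ e),
            HasMatrix E (companion (p ^ e) (p.natDegree * e)) → HasMatrix E A) →
          HasMatrix (D.restrict hW) C → HasMatrix D (fromBlocks A 0 0 C) := by
  obtain ⟨p, e, π, s, hp, hpm, he, hπs, hs, hW⟩ := exists_cyclic_split D
  have hdeg : (p ^ e).natDegree = p.natDegree * e := by rw [natDegree_pow, mul_comm]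
  have hE := hasMatrix_companion (hpm.pow e) _ hdeg
    (mul_ne_zero hp.natDegree_pos.ne' he)
  refine ⟨p, e, hp, hpm, he, LinearMap.ker π, hW, ?_, fun m n A C hA hC =>
    HasMatrix.fromBlocks_of_split hπs hs hW (hA _ hE) hC⟩
  have h1 := LinearMap.finrank_range_add_finrank_ker π
  rw [LinearMap.range_eq_top.2 fun u => ⟨s u, hπs u⟩, finrank_top, hE.card_eq_finrank,
    Fintype.card_fin] at h1
  omega

end CyclicSummand

/-! ### From companion matrices to real Jordan blocks -/

section CompanionToJordan

open Module Matrix Polynomial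

variable {V : Type*} [AddCommGroup V] [Module ℝ V]

/-- The indecomposable real Jordan blocks of size at most four, with nonreal eigenvalues
`a ± b i` normalized by `0 < b`. -/
inductive IsRealJordanBlock : ∀ {n : ℕ}, Matrix (Fin n) (Fin n) ℝ → Prop
  | one (a : ℝ) : IsRealJordanBlock !![a]
  | two (a : ℝ) : IsRealJordanBlock !![a, 1; 0, a]
  | three (a : ℝ) : IsRealJordanBlock !![a, 1, 0; 0, a, 1; 0, 0, a]
  | four (a : ℝ) : IsRealJordanBlock !![a, 1, 0, 0; 0, a, 1, 0; 0, 0, a, 1; 0, 0, 0, a]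
  | complexOne (a b : ℝ) (hb : 0 < b) : IsRealJordanBlock !![a, -b; b, a]
  | complexTwo (a b : ℝ) (hb : 0 < b) :
      IsRealJordanBlock !![a, -b, 1, 0; b, a, 0, 1; 0, 0, a, -b; 0, 0, b, a]

theorem companion_one (c₀ : ℝ) : companion (X + C c₀) 1 = !![-c₀] := by
  ext i j
  fin_cases i; fin_cases j
  simp [companion]

theorem companion_two (c₀ c₁ : ℝ) :
    companion (X ^ 2 + C c₁ * X + C c₀) 2 = !![0, -c₀; 1, -c₁] := by
  ext i j
  fin_cases i <;> fin_cases j <;> simp [companion, coeff_X, coeff_C, coeff_X_pow]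

theorem companion_three (c₀ c₁ c₂ : ℝ) :
    companion (X ^ 3 + C c₂ * X ^ 2 + C c₁ * X + C c₀) 3 =
      !![0, 0, -c₀; 1, 0, -c₁; 0, 1, -c₂] := by
  ext i j
  fin_cases i <;> fin_cases j <;> simp [companion, coeff_X, coeff_C, coeff_X_pow]

theorem companion_four (c₀ c₁ c₂ c₃ : ℝ) :
    companion (X ^ 4 + C c₃ * X ^ 3 + C c₂ * X ^ 2 + C c₁ * X + C c₀) 4 =
      !![0, 0, 0, -c₀; 1, 0, 0, -c₁; 0, 1, 0, -c₂; 0, 0, 1, -c₃] := by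
  ext i j
  fin_cases i <;> fin_cases j <;> simp [companion, coeff_X, coeff_C, coeff_X_pow]

/-- The degree is at most two. In degree two a nonnegative discriminant would give a real root, so
completing the square leaves a positive constant. -/
theorem Polynomial.eq_of_monic_irreducible_real {p : ℝ[X]} (hp : Irreducible p) (hm : p.Monic) :
    (∃ a : ℝ, p = X - C a) ∨ ∃ a b : ℝ, 0 < b ∧ p = (X - C a) ^ 2 + C (b ^ 2) := by
  have hle := hp.natDegree_le_two
  have hpos := hp.natDegree_pos
  have hexp := eq_quadratic_of_degree_le_two hp.degree_le_two
  obtain h | h : p.natDegree = 1 ∨ p.natDegree = 2 := by omega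
  · refine Or.inl ⟨-p.coeff 0, ?_⟩
    have h2 : p.coeff 2 = 0 := coeff_eq_zero_of_natDegree_lt (by omega)
    have h1 : p.coeff 1 = 1 := by rw [← h]; exact hm
    rw [h1, h2] at hexp
    rw [hexp]
    simp
  · right
    have h2 : p.coeff 2 = 1 := by rw [← h]; exact hm
    rw [h2] at hexp
    set u := p.coeff 1
    set w := p.coeff 0
    have hdisc : 0 < w - (u / 2) ^ 2 := by
      by_contra! hneg
      have hroot : p.IsRoot (-(u / 2) + √((u / 2) ^ 2 - w)) := by
        rw [IsRoot, hexp]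
        have hs := Real.mul_self_sqrt (show 0 ≤ (u / 2) ^ 2 - w by linarith)
        simp only [eval_add, eval_mul, eval_C, eval_pow, eval_X]
        linear_combination hs
      have := degree_eq_one_of_irreducible_of_root hp hroot
      rw [degree_eq_natDegree hp.ne_zero, h] at this
      norm_num at this
    refine ⟨-(u / 2), √(w - (u / 2) ^ 2), Real.sqrt_pos.2 hdisc, ?_⟩
    rw [Real.sq_sqrt hdisc.le, hexp]
    have hu : C u = 2 * C (u / 2) := by
      rw [← C_ofNat, ← C_mul]
      congr 1
      ring
    simp only [hu, C_neg, C_sub, C_pow, map_one]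
    ring

/-- The conjugating matrices list a Jordan basis of `ℝ[X] / (p ^ e)` in the power basis `1, x, x²,
…`. For `p = X - C a` it is `(x - a)^(e-1), …, x - a, 1`; for a quadratic `p` with `e = 1` it is `b,
x - a`. -/
theorem exists_isRealJordanBlock_of_companion {p : ℝ[X]} (hp : Irreducible p) (hm : p.Monic)
    {e : ℕ} (he : e ≠ 0) (hle : p.natDegree * e ≤ 4) :
    ∃ A : Matrix (Fin (p.natDegree * e)) (Fin (p.natDegree * e)) ℝ, IsRealJordanBlock A ∧
      ∀ {U : Type} [AddCommGroup U] [Module ℝ U] (E : U →ₗ[ℝ] U),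
        HasMatrix E (companion (p ^ e) (p.natDegree * e)) → HasMatrix E A := by
  rcases Polynomial.eq_of_monic_irreducible_real hp hm with ⟨a, rfl⟩ | ⟨a, b, hb, rfl⟩
  -- The matrix sizes depend on this product; generalizing it lets them become numerals.
  · generalize hn : (X - C a).natDegree * e = n at *
    rw [natDegree_X_sub_C, one_mul] at hn
    subst hn
    interval_cases e
    · exact absurd rfl he
    · refine ⟨_, .one a, fun {U} _ _ E hE => ?_⟩
      rw [show (X - C a) ^ 1 = X + C (-a) by simp; ring, companion_one, neg_neg] at hE
      exact hE
    · refine ⟨_, .two a, fun {U} _ _ E hE => ?_⟩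
      rw [show (X - C a) ^ 2 = X ^ 2 + C (-(2 * a)) * X + C (a ^ 2) by simp [map_ofNat]; ring,
        companion_two] at hE
      refine hE.conj !![-a, 1; 1, 0] (by simp) ?_
      ext i j
      fin_cases i <;> fin_cases j <;> simp [Matrix.mul_apply, Fin.sum_univ_succ] <;> ring
    · refine ⟨_, .three a, fun {U} _ _ E hE => ?_⟩
      rw [show (X - C a) ^ 3 = X ^ 3 + C (-(3 * a)) * X ^ 2 + C (3 * a ^ 2) * X + C (-a ^ 3) by
        simp [map_ofNat]; ring, companion_three] at hE
      refine hE.conj !![a ^ 2, -a, 1; -2 * a, 1, 0; 1, 0, 0] (by simp [Matrix.det_fin_three]) ?_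
      ext i j
      fin_cases i <;> fin_cases j <;> simp [Matrix.mul_apply, Fin.sum_univ_succ] <;> ring
    · refine ⟨_, .four a, fun {U} _ _ E hE => ?_⟩
      rw [show (X - C a) ^ 4 = X ^ 4 + C (-(4 * a)) * X ^ 3 + C (6 * a ^ 2) * X ^ 2 +
        C (-(4 * a ^ 3)) * X + C (a ^ 4) by simp [map_ofNat]; ring, companion_four] at hE
      refine hE.conj !![-a ^ 3, a ^ 2, -a, 1; 3 * a ^ 2, -2 * a, 1, 0; -3 * a, 1, 0, 0; 1, 0, 0, 0]
        (by simp [Matrix.det_succ_row_zero, Fin.sum_univ_succ, Fin.succAbove]) ?_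
      ext i j
      fin_cases i <;> fin_cases j <;> simp [Matrix.mul_apply, Fin.sum_univ_succ] <;> ring
  · have hdeg : ((X - C a) ^ 2 + C (b ^ 2)).natDegree = 2 := by
      rw [natDegree_add_C, natDegree_pow, natDegree_X_sub_C]
    generalize hn : ((X - C a) ^ 2 + C (b ^ 2)).natDegree * e = n at *
    rw [hdeg] at hn
    subst hn
    obtain rfl | rfl : e = 1 ∨ e = 2 := by omega
    · refine ⟨_, .complexOne a b hb, fun {U} _ _ E hE => ?_⟩
      rw [show ((X - C a) ^ 2 + C (b ^ 2)) ^ 1 = X ^ 2 + C (-(2 * a)) * X + C (a ^ 2 + b ^ 2) by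
        simp [map_ofNat]; ring, companion_two] at hE
      refine hE.conj !![b, -a; 0, 1] (by simpa using hb.ne') ?_
      ext i j
      fin_cases i <;> fin_cases j <;> simp [Matrix.mul_apply, Fin.sum_univ_succ] <;> ring
    · refine ⟨_, .complexTwo a b hb, fun {U} _ _ E hE => ?_⟩
      rw [show ((X - C a) ^ 2 + C (b ^ 2)) ^ 2 = X ^ 4 + C (-(4 * a)) * X ^ 3 +
        C (6 * a ^ 2 + 2 * b ^ 2) * X ^ 2 + C (-(4 * a ^ 3 + 4 * a * b ^ 2)) * X +
        C ((a ^ 2 + b ^ 2) ^ 2) by simp [map_ofNat]; ring, companion_four] at hE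
      -- With `q = (x - a)² + b²`, the columns are `-b (x - a) q`, `b² q`, `2 b³` and `(x - a)(q + 2
      -- b²)`. The first two span the ideal generated by `q`, and the factors are chosen so that the
      -- upper right block is the identity.
      refine hE.conj
        !![b * (a ^ 3 + a * b ^ 2), b ^ 2 * (a ^ 2 + b ^ 2), 2 * b ^ 3, -a ^ 3 - 3 * a * b ^ 2;
           -b * (3 * a ^ 2 + b ^ 2), -2 * a * b ^ 2, 0, 3 * a ^ 2 + 3 * b ^ 2;
           3 * a * b, b ^ 2, 0, -3 * a;
           -b, 0, 0, 1] ?_ ?_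
      · have : (4 * b ^ 8 : ℝ) ≠ 0 := by positivity
        convert! this using 1
        simp [Matrix.det_succ_row_zero, Fin.sum_univ_succ, Fin.succAbove]
        ring
      · ext i j
        fin_cases i <;> fin_cases j <;> simp [Matrix.mul_apply, Fin.sum_univ_succ] <;> ring

theorem exists_isRealJordanBlock_split [FiniteDimensional ℝ V] [Nontrivial V] (D : V →ₗ[ℝ] V)
    (hV : finrank ℝ V ≤ 4) :
    ∃ (n : ℕ) (A : Matrix (Fin n) (Fin n) ℝ), IsRealJordanBlock A ∧
      ∃ (W : Submodule ℝ V) (hW : ∀ w ∈ W, D w ∈ W), finrank ℝ W + n = finrank ℝ V ∧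
        ∀ (m : ℕ) (C : Matrix (Fin m) (Fin m) ℝ),
          HasMatrix (D.restrict hW) C → HasMatrix D (fromBlocks A 0 0 C) := by
  obtain ⟨p, e, hp, hm, he, W, hW, hdim, hsplit⟩ := exists_companion_split D
  obtain ⟨A, hA, hE⟩ := exists_isRealJordanBlock_of_companion hp hm he (by omega)
  exact ⟨_, A, hA, W, hW, hdim, fun m C hC => hsplit m _ A C hE hC⟩

end CompanionToJordan

/-! ### Real Jordan forms up to size four -/

section RealJordanForms

open Module Matrix

variable {V : Type*} [AddCommGroup V] [Module ℝ V] [FiniteDimensional ℝ V]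

/-- Real Jordan forms of size two. -/
inductive IsRealJordanFormTwo : Matrix (Fin 2) (Fin 2) ℝ → Prop
  | diag (a b : ℝ) : IsRealJordanFormTwo !![a, 0; 0, b]
  | two (a : ℝ) : IsRealJordanFormTwo !![a, 1; 0, a]
  | complexOne (a b : ℝ) (hb : 0 < b) : IsRealJordanFormTwo !![a, -b; b, a]

/-- Real Jordan forms of size three. -/
inductive IsRealJordanFormThree : Matrix (Fin 3) (Fin 3) ℝ → Prop
  | diag (a b c : ℝ) : IsRealJordanFormThree !![a, 0, 0; 0, b, 0; 0, 0, c]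
  | two (a b : ℝ) : IsRealJordanFormThree !![a, 0, 0; 0, b, 1; 0, 0, b]
  | complexOne (a b c : ℝ) (hc : 0 < c) : IsRealJordanFormThree !![a, 0, 0; 0, b, -c; 0, c, b]
  | three (a : ℝ) : IsRealJordanFormThree !![a, 1, 0; 0, a, 1; 0, 0, a]

/-- Real Jordan forms of size four. -/
inductive IsRealJordanFormFour : Matrix (Fin 4) (Fin 4) ℝ → Prop
  | diag (x : Fin 4 → ℝ) : IsRealJordanFormFour (diagonal x)
  | two (a b c : ℝ) :
      IsRealJordanFormFour !![a, 0, 0, 0; 0, b, 0, 0; 0, 0, c, 1; 0, 0, 0, c]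
  | complexOne (a b c d : ℝ) (hd : 0 < d) :
      IsRealJordanFormFour !![a, 0, 0, 0; 0, b, 0, 0; 0, 0, c, -d; 0, 0, d, c]
  | three (a b : ℝ) :
      IsRealJordanFormFour !![a, 0, 0, 0; 0, b, 1, 0; 0, 0, b, 1; 0, 0, 0, b]
  | twoTwo (a b : ℝ) :
      IsRealJordanFormFour !![a, 1, 0, 0; 0, a, 0, 0; 0, 0, b, 1; 0, 0, 0, b]
  | twoComplexOne (a b c : ℝ) (hc : 0 < c) :
      IsRealJordanFormFour !![a, 1, 0, 0; 0, a, 0, 0; 0, 0, b, -c; 0, 0, c, b]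
  | complexOneComplexOne (a b c d : ℝ) (hb : 0 < b) (hd : 0 < d) :
      IsRealJordanFormFour !![a, -b, 0, 0; b, a, 0, 0; 0, 0, c, -d; 0, 0, d, c]
  | four (a : ℝ) :
      IsRealJordanFormFour !![a, 1, 0, 0; 0, a, 1, 0; 0, 0, a, 1; 0, 0, 0, a]
  | complexTwo (a b : ℝ) (hb : 0 < b) :
      IsRealJordanFormFour !![a, -b, 1, 0; b, a, 0, 1; 0, 0, a, -b; 0, 0, b, a]

theorem hasMatrix_of_finrank_eq_zero (D : V →ₗ[ℝ] V) (h : finrank ℝ V = 0)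
    (M : Matrix (Fin 0) (Fin 0) ℝ) : HasMatrix D M :=
  ⟨finBasisOfFinrankEq ℝ V h, fun j => j.elim0⟩

theorem exists_hasMatrix_one (D : V →ₗ[ℝ] V) (h : finrank ℝ V = 1) :
    ∃ a : ℝ, HasMatrix D !![a] := by
  have : Nontrivial V := nontrivial_of_finrank_pos (R := ℝ) (by omega)
  obtain ⟨n, A, hA, W, hW, hdim, hD⟩ := exists_isRealJordanBlock_split D (by omega)
  cases hA with
  | one a =>
    refine ⟨a, (hD 0 0 (hasMatrix_of_finrank_eq_zero _ (by omega) _)).reindex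
      finSumFinEquiv ?_⟩
    rintro (i | i) (j | j) <;> fin_cases i <;> fin_cases j <;> rfl
  | _ => omega

/-- A block is split off and the smaller sizes are applied to the complement, here and in sizes
three and four; a block that is too large contradicts the dimension. -/
theorem exists_hasMatrix_two (D : V →ₗ[ℝ] V) (h : finrank ℝ V = 2) :
    ∃ M, IsRealJordanFormTwo M ∧ HasMatrix D M := by
  have : Nontrivial V := nontrivial_of_finrank_pos (R := ℝ) (by omega)
  obtain ⟨n, A, hA, W, hW, hdim, hD⟩ := exists_isRealJordanBlock_split D (by omega)
  cases hA with
  | one a =>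
    obtain ⟨b, hb⟩ := exists_hasMatrix_one (D.restrict hW) (by omega)
    refine ⟨_, .diag a b, (hD _ _ hb).reindex finSumFinEquiv ?_⟩
    rintro (i | i) (j | j) <;> fin_cases i <;> fin_cases j <;> rfl
  | two a =>
    refine ⟨_, .two a, (hD 0 0 (hasMatrix_of_finrank_eq_zero _ (by omega) _)).reindex
      finSumFinEquiv ?_⟩
    rintro (i | i) (j | j) <;> fin_cases i <;> fin_cases j <;> rfl
  | complexOne a b hb =>
    refine ⟨_, .complexOne a b hb, (hD 0 0 (hasMatrix_of_finrank_eq_zero _ (by omega) _)).reindex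
      finSumFinEquiv ?_⟩
    rintro (i | i) (j | j) <;> fin_cases i <;> fin_cases j <;> rfl
  | _ => omega

theorem exists_hasMatrix_three (D : V →ₗ[ℝ] V) (h : finrank ℝ V = 3) :
    ∃ M, IsRealJordanFormThree M ∧ HasMatrix D M := by
  have : Nontrivial V := nontrivial_of_finrank_pos (R := ℝ) (by omega)
  obtain ⟨n, A, hA, W, hW, hdim, hD⟩ := exists_isRealJordanBlock_split D (by omega)
  cases hA with
  | one a =>
    obtain ⟨C, hC, hCW⟩ := exists_hasMatrix_two (D.restrict hW) (by omega)
    cases hC with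
    | diag b c =>
      refine ⟨_, .diag a b c, (hD _ _ hCW).reindex finSumFinEquiv ?_⟩
      rintro (i | i) (j | j) <;> fin_cases i <;> fin_cases j <;> rfl
    | two b =>
      refine ⟨_, .two a b, (hD _ _ hCW).reindex finSumFinEquiv ?_⟩
      rintro (i | i) (j | j) <;> fin_cases i <;> fin_cases j <;> rfl
    | complexOne b c hc =>
      refine ⟨_, .complexOne a b c hc, (hD _ _ hCW).reindex finSumFinEquiv ?_⟩
      rintro (i | i) (j | j) <;> fin_cases i <;> fin_cases j <;> rfl
  | two a =>
    obtain ⟨b, hb⟩ := exists_hasMatrix_one (D.restrict hW) (by omega)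
    -- The listed form has the larger block last, so the two summands are exchanged.
    refine ⟨_, .two b a, (hD _ _ hb).reindex ((Equiv.sumComm _ _).trans finSumFinEquiv) ?_⟩
    rintro (i | i) (j | j) <;> fin_cases i <;> fin_cases j <;> rfl
  | complexOne a c hc =>
    obtain ⟨b, hb⟩ := exists_hasMatrix_one (D.restrict hW) (by omega)
    refine ⟨_, .complexOne b a c hc,
      (hD _ _ hb).reindex ((Equiv.sumComm _ _).trans finSumFinEquiv) ?_⟩
    rintro (i | i) (j | j) <;> fin_cases i <;> fin_cases j <;> rfl
  | three a =>
    refine ⟨_, .three a, (hD 0 0 (hasMatrix_of_finrank_eq_zero _ (by omega) _)).reindex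
      finSumFinEquiv ?_⟩
    rintro (i | i) (j | j) <;> fin_cases i <;> fin_cases j <;> rfl
  | _ => omega

theorem exists_hasMatrix_four (D : V →ₗ[ℝ] V) (h : finrank ℝ V = 4) :
    ∃ M, IsRealJordanFormFour M ∧ HasMatrix D M := by
  have : Nontrivial V := nontrivial_of_finrank_pos (R := ℝ) (by omega)
  obtain ⟨n, A, hA, W, hW, hdim, hD⟩ := exists_isRealJordanBlock_split D (by omega)
  cases hA with
  | one a =>
    obtain ⟨C, hC, hCW⟩ := exists_hasMatrix_three (D.restrict hW) (by omega)
    cases hC with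
    | diag b c d =>
      refine ⟨_, .diag ![a, b, c, d], (hD _ _ hCW).reindex finSumFinEquiv ?_⟩
      rintro (i | i) (j | j) <;> fin_cases i <;> fin_cases j <;> rfl
    | two b c =>
      refine ⟨_, .two a b c, (hD _ _ hCW).reindex finSumFinEquiv ?_⟩
      rintro (i | i) (j | j) <;> fin_cases i <;> fin_cases j <;> rfl
    | complexOne b c d hd =>
      refine ⟨_, .complexOne a b c d hd, (hD _ _ hCW).reindex finSumFinEquiv ?_⟩
      rintro (i | i) (j | j) <;> fin_cases i <;> fin_cases j <;> rfl
    | three b =>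
      refine ⟨_, .three a b, (hD _ _ hCW).reindex finSumFinEquiv ?_⟩
      rintro (i | i) (j | j) <;> fin_cases i <;> fin_cases j <;> rfl
  | two a =>
    obtain ⟨C, hC, hCW⟩ := exists_hasMatrix_two (D.restrict hW) (by omega)
    cases hC with
    | diag b c =>
      refine ⟨_, .two b c a, (hD _ _ hCW).reindex ((Equiv.sumComm _ _).trans finSumFinEquiv) ?_⟩
      rintro (i | i) (j | j) <;> fin_cases i <;> fin_cases j <;> rfl
    | two b =>
      refine ⟨_, .twoTwo a b, (hD _ _ hCW).reindex finSumFinEquiv ?_⟩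
      rintro (i | i) (j | j) <;> fin_cases i <;> fin_cases j <;> rfl
    | complexOne b c hc =>
      refine ⟨_, .twoComplexOne a b c hc, (hD _ _ hCW).reindex finSumFinEquiv ?_⟩
      rintro (i | i) (j | j) <;> fin_cases i <;> fin_cases j <;> rfl
  | complexOne a d hd =>
    obtain ⟨C, hC, hCW⟩ := exists_hasMatrix_two (D.restrict hW) (by omega)
    cases hC with
    | diag b c =>
      refine ⟨_, .complexOne b c a d hd,
        (hD _ _ hCW).reindex ((Equiv.sumComm _ _).trans finSumFinEquiv) ?_⟩
      rintro (i | i) (j | j) <;> fin_cases i <;> fin_cases j <;> rfl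
    | two b =>
      refine ⟨_, .twoComplexOne b a d hd,
        (hD _ _ hCW).reindex ((Equiv.sumComm _ _).trans finSumFinEquiv) ?_⟩
      rintro (i | i) (j | j) <;> fin_cases i <;> fin_cases j <;> rfl
    | complexOne b c hc =>
      refine ⟨_, .complexOneComplexOne a d b c hd hc, (hD _ _ hCW).reindex finSumFinEquiv ?_⟩
      rintro (i | i) (j | j) <;> fin_cases i <;> fin_cases j <;> rfl
  | three a =>
    obtain ⟨b, hb⟩ := exists_hasMatrix_one (D.restrict hW) (by omega)
    refine ⟨_, .three b a, (hD _ _ hb).reindex ((Equiv.sumComm _ _).trans finSumFinEquiv) ?_⟩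
    rintro (i | i) (j | j) <;> fin_cases i <;> fin_cases j <;> rfl
  | four a =>
    refine ⟨_, .four a, (hD 0 0 (hasMatrix_of_finrank_eq_zero _ (by omega) _)).reindex
      finSumFinEquiv ?_⟩
    rintro (i | i) (j | j) <;> fin_cases i <;> fin_cases j <;> rfl
  | complexTwo a b hb =>
    refine ⟨_, .complexTwo a b hb, (hD 0 0 (hasMatrix_of_finrank_eq_zero _ (by omega) _)).reindex
      finSumFinEquiv ?_⟩
    rintro (i | i) (j | j) <;> fin_cases i <;> fin_cases j <;> rfl

end RealJordanForms

/-! ### Positivity and normalization of the Jordan form -/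

section Normalization

open Module Matrix

variable {V : Type*} [AddCommGroup V] [Module ℝ V] {D : V →ₗ[ℝ] V}
  {B : LinearMap.BilinForm ℝ V}

/-- The vector `b j` is an eigenvector for `M j j`, and the form takes the value `M j j * B (b j) (b
j)` on it. -/
theorem HasMatrix.pos_of_eigenvector {n : Type*} [Fintype n] {M : Matrix n n ℝ}
    (h : HasMatrix D M) (hB : IsInnerProduct B) (hD : ∀ x, x ≠ 0 → 0 < B (D x) x) (j : n)
    (hj : ∀ i, i ≠ j → M i j = 0) : 0 < M j j := by
  obtain ⟨b, hb⟩ := h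
  have h₁ := hD (b j) (b.ne_zero j)
  rw [hb, Finset.sum_eq_single j (fun i _ hi => by simp [hj i hi]) (by simp)] at h₁
  simp only [map_smul, LinearMap.smul_apply, smul_eq_mul] at h₁
  exact pos_of_mul_pos_left h₁ (hB.pos_def _ (b.ne_zero j)).le

/-- On the invariant plane of `b j` and `b k`, adding the values of the form at these two vectors
cancels the mixed terms, so no orthogonality is needed. -/
theorem HasMatrix.pos_of_rotation {n : Type*} [Fintype n] {M : Matrix n n ℝ}
    (h : HasMatrix D M) (hB : IsInnerProduct B) (hD : ∀ x, x ≠ 0 → 0 < B (D x) x) (j k : n)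
    (hjk : j ≠ k) (hj : ∀ i, i ≠ j → i ≠ k → M i j = 0) (hk : ∀ i, i ≠ j → i ≠ k → M i k = 0)
    (hsymm : M k k = M j j) (hskew : M j k = -M k j) : 0 < M j j := by
  classical
  obtain ⟨b, hb⟩ := h
  have hsum : ∀ l, (∀ i, i ≠ j → i ≠ k → M i l = 0) → D (b l) = M j l • b j + M k l • b k := by
    intro l hl
    rw [hb, ← Finset.sum_pair (f := fun i => M i l • b i) hjk]
    refine (Finset.sum_subset (Finset.subset_univ _) fun i _ hi => ?_).symm
    simp only [Finset.mem_insert, Finset.mem_singleton, not_or] at hi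
    rw [hl i hi.1 hi.2, zero_smul]
  have h₁ := hD (b j) (b.ne_zero j)
  have h₂ := hD (b k) (b.ne_zero k)
  rw [hsum j hj] at h₁
  rw [hsum k hk] at h₂
  simp only [map_add, map_smul, LinearMap.add_apply, LinearMap.smul_apply, smul_eq_mul] at h₁ h₂
  rw [hB.symm (b k) (b j)] at h₁
  rw [hsymm, hskew] at h₂
  have h₃ : 0 < M j j * (B (b j) (b j) + B (b k) (b k)) := by linarith
  exact pos_of_mul_pos_left h₃
    (add_pos (hB.pos_def _ (b.ne_zero j)) (hB.pos_def _ (b.ne_zero k))).le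

set_option maxHeartbeats 1000000 in
/-- An operator with positive definite symmetric part on a four-dimensional space has, up to
scaling, one of the normal forms. -/
theorem exists_normalForm [FiniteDimensional ℝ V] (hV : finrank ℝ V = 4)
    (hB : IsInnerProduct B) (hD : ∀ x, x ≠ 0 → 0 < B (D x) x) :
    ∃ (p : NormalForm) (c : ℝ), p.Admissible ∧ c ≠ 0 ∧ HasMatrix (c • D) p.matrix := by
  obtain ⟨M, hM, h⟩ := exists_hasMatrix_four D hV
  cases hM with
  | diag x =>
    have hpos : ∀ i, 0 < x i := fun i => by
      have := h.pos_of_eigenvector hB hD i fun k hk => diagonal_apply_ne _ hk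
      simpa using this
    have hmono := Tuple.monotone_sort x
    set σ := Tuple.sort x
    have h' : HasMatrix D (diagonal (x ∘ σ)) := h.reindex σ.symm fun i j => by
      by_cases hij : i = j
      · simp [hij]
      · simp [hij]
    have h3 := hpos (σ 3)
    have hle : ∀ i j, i ≤ j → (x (σ 3))⁻¹ * x (σ i) ≤ (x (σ 3))⁻¹ * x (σ j) := fun i j hij =>
      mul_le_mul_of_nonneg_left (hmono hij) (inv_pos.2 h3).le
    have hle3 := hle 2 3 (by decide)
    rw [inv_mul_cancel₀ h3.ne'] at hle3
    refine ⟨.type1 ((x (σ 3))⁻¹ * x (σ 0)) ((x (σ 3))⁻¹ * x (σ 1)) ((x (σ 3))⁻¹ * x (σ 2)),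
      (x (σ 3))⁻¹, ⟨mul_pos (inv_pos.2 h3) (hpos _), hle 0 1 (by decide), hle 1 2 (by decide),
        hle3⟩, (inv_pos.2 h3).ne', ?_⟩
    convert! h'.smul (x (σ 3))⁻¹
    ext i j
    fin_cases i <;> fin_cases j <;> simp [NormalForm.matrix, h3.ne']
  | two a b c =>
    have ha : 0 < a := h.pos_of_eigenvector hB hD 0 (by
      intro i hi; fin_cases i <;> first | rfl | exact absurd rfl hi)
    have hb : 0 < b := h.pos_of_eigenvector hB hD 1 (by
      intro i hi; fin_cases i <;> first | rfl | exact absurd rfl hi)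
    have hc : 0 < c := h.pos_of_eigenvector hB hD 2 (by
      intro i hi; fin_cases i <;> first | rfl | exact absurd rfl hi)
    wlog hab : a ≤ b generalizing a b
    · refine this b a (h.conj !![0, 1, 0, 0; 1, 0, 0, 0; 0, 0, 1, 0; 0, 0, 0, 1]
        (by simp [det_succ_row_zero, Fin.sum_univ_succ, Fin.succAbove]) ?_) hb ha (le_of_not_ge hab)
      ext i j
      fin_cases i <;> fin_cases j <;> simp [mul_apply, Fin.sum_univ_succ]
    -- Scaling by `c⁻¹` makes the repeated eigenvalue `1` but turns the off-diagonal `1` into `c⁻¹`;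
    -- conjugation by a diagonal matrix restores it. The other nontrivial Jordan blocks are treated
    -- alike.
    refine ⟨.type2 (c⁻¹ * a) (c⁻¹ * b), c⁻¹, ⟨by positivity, by gcongr⟩, by positivity,
      (h.smul c⁻¹).conj (diagonal ![1, 1, c⁻¹, 1])
        (by simp [det_diagonal, Fin.prod_univ_succ, hc.ne']) ?_⟩
    ext i j
    rw [mul_diagonal, diagonal_mul]
    fin_cases i <;> fin_cases j <;> simp [NormalForm.matrix, hc.ne']
  | complexOne a b c d hd =>
    have ha : 0 < a := h.pos_of_eigenvector hB hD 0 (by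
      intro i hi; fin_cases i <;> first | rfl | exact absurd rfl hi)
    have hb : 0 < b := h.pos_of_eigenvector hB hD 1 (by
      intro i hi; fin_cases i <;> first | rfl | exact absurd rfl hi)
    have hc : 0 < c := h.pos_of_rotation hB hD 2 3 (by decide)
      (by intro i hi hi'; fin_cases i <;> first | rfl | exact absurd rfl hi | exact absurd rfl hi')
      (by intro i hi hi'; fin_cases i <;> first | rfl | exact absurd rfl hi | exact absurd rfl hi')
      rfl rfl
    wlog hab : a ≤ b generalizing a b
    · refine this b a (h.conj !![0, 1, 0, 0; 1, 0, 0, 0; 0, 0, 1, 0; 0, 0, 0, 1]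
        (by simp [det_succ_row_zero, Fin.sum_univ_succ, Fin.succAbove]) ?_) hb ha (le_of_not_ge hab)
      ext i j
      fin_cases i <;> fin_cases j <;> simp [mul_apply, Fin.sum_univ_succ]
    refine ⟨.type3 (c⁻¹ * a) (c⁻¹ * b) (c⁻¹ * d), c⁻¹,
      ⟨by positivity, by gcongr, by positivity⟩, by positivity, ?_⟩
    convert! h.smul c⁻¹
    ext i j
    fin_cases i <;> fin_cases j <;> simp [NormalForm.matrix, hc.ne']
  | three a b =>
    have ha : 0 < a := h.pos_of_eigenvector hB hD 0 (by
      intro i hi; fin_cases i <;> first | rfl | exact absurd rfl hi)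
    have hb : 0 < b := h.pos_of_eigenvector hB hD 1 (by
      intro i hi; fin_cases i <;> first | rfl | exact absurd rfl hi)
    refine ⟨.type4 (b⁻¹ * a), b⁻¹, show 0 < b⁻¹ * a by positivity, by positivity,
      (h.smul b⁻¹).conj (diagonal ![1, b⁻¹ ^ 2, b⁻¹, 1])
        (by simp [det_diagonal, Fin.prod_univ_succ, hb.ne']) ?_⟩
    ext i j
    rw [mul_diagonal, diagonal_mul]
    fin_cases i <;> fin_cases j <;>
      simp [NormalForm.matrix, hb.ne'] <;> field_simp
  | twoTwo a b =>
    have ha : 0 < a := h.pos_of_eigenvector hB hD 0 (by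
      intro i hi; fin_cases i <;> first | rfl | exact absurd rfl hi)
    have hb : 0 < b := h.pos_of_eigenvector hB hD 2 (by
      intro i hi; fin_cases i <;> first | rfl | exact absurd rfl hi)
    wlog hab : a ≤ b generalizing a b
    · refine this b a (h.conj !![0, 0, 1, 0; 0, 0, 0, 1; 1, 0, 0, 0; 0, 1, 0, 0]
        (by simp [det_succ_row_zero, Fin.sum_univ_succ, Fin.succAbove]) ?_) hb ha (le_of_not_ge hab)
      ext i j
      fin_cases i <;> fin_cases j <;> simp [mul_apply, Fin.sum_univ_succ]
    refine ⟨.type5 (b⁻¹ * a), b⁻¹, ⟨by positivity, ?_⟩, by positivity,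
      (h.smul b⁻¹).conj (diagonal ![b⁻¹, 1, b⁻¹, 1])
        (by simp [det_diagonal, Fin.prod_univ_succ, hb.ne']) ?_⟩
    · rwa [inv_mul_le_iff₀ hb, mul_one]
    · ext i j
      rw [mul_diagonal, diagonal_mul]
      fin_cases i <;> fin_cases j <;>
        simp [NormalForm.matrix, hb.ne', mul_comm]
  | twoComplexOne a b c hc =>
    have ha : 0 < a := h.pos_of_eigenvector hB hD 0 (by
      intro i hi; fin_cases i <;> first | rfl | exact absurd rfl hi)
    have hb : 0 < b := h.pos_of_rotation hB hD 2 3 (by decide)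
      (by intro i hi hi'; fin_cases i <;> first | rfl | exact absurd rfl hi | exact absurd rfl hi')
      (by intro i hi hi'; fin_cases i <;> first | rfl | exact absurd rfl hi | exact absurd rfl hi')
      rfl rfl
    refine ⟨.type6 (b⁻¹ * a) (b⁻¹ * c), b⁻¹, ⟨by positivity, by positivity⟩, by positivity,
      (h.smul b⁻¹).conj (diagonal ![b⁻¹, 1, 1, 1])
        (by simp [det_diagonal, Fin.prod_univ_succ, hb.ne']) ?_⟩
    ext i j
    rw [mul_diagonal, diagonal_mul]
    fin_cases i <;> fin_cases j <;>
      simp [NormalForm.matrix, hb.ne', mul_comm]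
  | complexOneComplexOne a b c d hb hd =>
    have ha : 0 < a := h.pos_of_rotation hB hD 0 1 (by decide)
      (by intro i hi hi'; fin_cases i <;> first | rfl | exact absurd rfl hi | exact absurd rfl hi')
      (by intro i hi hi'; fin_cases i <;> first | rfl | exact absurd rfl hi | exact absurd rfl hi')
      rfl rfl
    have hc : 0 < c := h.pos_of_rotation hB hD 2 3 (by decide)
      (by intro i hi hi'; fin_cases i <;> first | rfl | exact absurd rfl hi | exact absurd rfl hi')
      (by intro i hi hi'; fin_cases i <;> first | rfl | exact absurd rfl hi | exact absurd rfl hi')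
      rfl rfl
    -- Lexicographic order of the blocks: the imaginary parts are compared only when the real parts
    -- agree, as in the range of `type7`.
    wlog hac : a < c ∨ a = c ∧ b ≤ d generalizing a b c d
    · refine this c d a b hd hb (h.conj !![0, 0, 1, 0; 0, 0, 0, 1; 1, 0, 0, 0; 0, 1, 0, 0]
        (by simp [det_succ_row_zero, Fin.sum_univ_succ, Fin.succAbove]) ?_) hc ha ?_
      · ext i j
        fin_cases i <;> fin_cases j <;> simp [mul_apply, Fin.sum_univ_succ]
      · rcases lt_trichotomy a c with h₁ | h₁ | h₁
        · exact absurd (Or.inl h₁) hac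
        · exact Or.inr ⟨h₁.symm, le_of_not_ge fun h₂ => hac (Or.inr ⟨h₁, h₂⟩)⟩
        · exact Or.inl h₁
    refine ⟨.type7 (c⁻¹ * a) (c⁻¹ * b) (c⁻¹ * d), c⁻¹,
      ⟨by positivity, ?_, by positivity, by positivity, fun h1 => ?_⟩, by positivity, ?_⟩
    · rw [inv_mul_le_iff₀ hc, mul_one]
      exact hac.elim le_of_lt fun h' => h'.1.le
    · rw [inv_mul_eq_one₀ hc.ne'] at h1
      have hbd : b ≤ d := hac.elim (fun h' => absurd h1 h'.ne') fun h' => h'.2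
      gcongr
    · convert! h.smul c⁻¹
      ext i j
      fin_cases i <;> fin_cases j <;> simp [NormalForm.matrix, hc.ne']
  | four a =>
    have ha : 0 < a := h.pos_of_eigenvector hB hD 0 (by
      intro i hi; fin_cases i <;> first | rfl | exact absurd rfl hi)
    refine ⟨.type8, a⁻¹, trivial, by positivity,
      (h.smul a⁻¹).conj (diagonal ![a⁻¹ ^ 3, a⁻¹ ^ 2, a⁻¹, 1])
        (by simp [det_diagonal, Fin.prod_univ_succ, ha.ne']) ?_⟩
    ext i j
    rw [mul_diagonal, diagonal_mul]
    fin_cases i <;> fin_cases j <;>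
      simp [NormalForm.matrix, ha.ne'] <;> field_simp
  | complexTwo a b hb =>
    have ha : 0 < a := h.pos_of_rotation hB hD 0 1 (by decide)
      (by intro i hi hi'; fin_cases i <;> first | rfl | exact absurd rfl hi | exact absurd rfl hi')
      (by intro i hi hi'; fin_cases i <;> first | rfl | exact absurd rfl hi | exact absurd rfl hi')
      rfl rfl
    refine ⟨.type9 (a⁻¹ * b), a⁻¹, show 0 < a⁻¹ * b by positivity, by positivity,
      (h.smul a⁻¹).conj (diagonal ![a⁻¹, a⁻¹, 1, 1])
        (by simp [det_diagonal, Fin.prod_univ_succ, ha.ne']) ?_⟩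
    ext i j
    rw [mul_diagonal, diagonal_mul]
    fin_cases i <;> fin_cases j <;>
      simp [NormalForm.matrix, ha.ne', mul_comm]

end Normalization

/-! ### Existence of a normal form -/

section Existence

open Module

theorem IsSNC.exists_normalForm {g : Type*} [LieRing g] [LieAlgebra ℝ g]
    (hdim : finrank ℝ g = 5) (hg : IsSNC g) (hab : IsLieAbelian (derivedAlgebra g)) :
    finrank ℝ (derivedAlgebra g) = 4 ∧
      ∃ (p : NormalForm) (e : Basis (Fin 4) ℝ (derivedAlgebra g)) (e₅ : g),
        p.Admissible ∧ e₅ ∉ derivedAlgebra g ∧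
        ∀ j : Fin 4, ⁅e₅, (e j : g)⁆ = ∑ i : Fin 4, p.matrix i j • (e i : g) := by
  have : FiniteDimensional ℝ g := FiniteDimensional.of_finrank_pos (by omega)
  obtain ⟨hcod, A, B, hA, hB, hpos⟩ := hg.exists_positive (by omega) hab
  have h4 : finrank ℝ (derivedAlgebra g) = 4 := by omega
  let D : derivedAlgebra g →ₗ[ℝ] derivedAlgebra g :=
    (LieAlgebra.ad ℝ g A : g →ₗ[ℝ] g).restrict
      (p := (derivedAlgebra g).toSubmodule) (q := (derivedAlgebra g).toSubmodule)
      fun X _ => lie_mem_derivedAlgebra A X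
  let B' : LinearMap.BilinForm ℝ (derivedAlgebra g) :=
    B.compl₁₂ (derivedAlgebra g).toSubmodule.subtype (derivedAlgebra g).toSubmodule.subtype
  have hB' : IsInnerProduct B' :=
    ⟨fun x y => hB.symm x y, fun x hx => hB.pos_def x fun h => hx (Subtype.ext h)⟩
  have hD : ∀ x, x ≠ 0 → 0 < B' (D x) x := fun x hx =>
    hpos x x.2 fun h => hx (Subtype.ext h)
  obtain ⟨p, c, hp, hc, b, hb⟩ := _root_.exists_normalForm h4 hB' hD
  refine ⟨h4, p, b, c • A, hp, fun hmem => hA ?_, fun j => ?_⟩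
  · have := (derivedAlgebra g).smul_mem c⁻¹ hmem
    rwa [inv_smul_smul₀ hc] at this
  · have := congrArg Subtype.val (hb j)
    rw [smul_lie]
    exact Eq.trans rfl (this.trans (by simp))

end Existence

/-! ### Isomorphic expanded algebras have matrices similar up to scale -/

section ExpandedIso

open Matrix

/-- Since `M` is invertible, every vector of `ℝ⁴` is a bracket, so `φ` maps `ℝ⁴` into `ℝ⁴`; `P` is
this restriction. The scalar `c` is the `e₅`-component of `φ e₅`, because the `ℝ⁴`-component of `φ
e₅` acts trivially on `ℝ⁴`. -/
theorem ExpandedAlgebra.exists_similar_of_equiv {M M' : Matrix (Fin 4) (Fin 4) ℝ}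
    (hM : M.det ≠ 0) (φ : ExpandedAlgebra M ≃ₗ⁅ℝ⁆ ExpandedAlgebra M') :
    ∃ (P : Matrix (Fin 4) (Fin 4) ℝ) (c : ℝ), P.det ≠ 0 ∧ c ≠ 0 ∧ P * M = c • M' * P := by
  have hM0 : M ≠ 0 := fun h => hM (by simp [h])
  let i (v : Fin 4 → ℝ) : ExpandedAlgebra M := (v, 0)
  let t : ExpandedAlgebra M := ((0 : Fin 4 → ℝ), (1 : ℝ))
  have hbr : ∀ v, ⁅t, i v⁆ = i (M *ᵥ v) := fun v => by
    apply ExpandedAlgebra.ext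
    · rw [ExpandedAlgebra.bracket_fst]
      simp [t, i]
    · rfl
  have hsnd : ∀ v, (φ (i v)).2 = 0 := fun v => by
    have : i v = ⁅t, i (M⁻¹ *ᵥ v)⁆ := by
      rw [hbr, mulVec_mulVec, mul_nonsing_inv _ (isUnit_iff_ne_zero.2 hM), one_mulVec]
    rw [this, LieEquiv.map_lie]
    rfl
  let f : (Fin 4 → ℝ) →ₗ[ℝ] (Fin 4 → ℝ) :=
    { toFun := fun v => (φ (i v)).1
      map_add' := fun v w => by
        have : i (v + w) = i v + i w := ExpandedAlgebra.ext rfl (add_zero (0 : ℝ)).symm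
        rw [this, map_add, ExpandedAlgebra.add_fst]
      map_smul' := fun c v => by
        have : i (c • v) = c • i v := ExpandedAlgebra.ext rfl (mul_zero c).symm
        rw [this, map_smul, ExpandedAlgebra.smul_fst]
        rfl }
  have hinj : Function.Injective f := fun v w h => by
    have h' : φ (i v) = φ (i w) := ExpandedAlgebra.ext h ((hsnd v).trans (hsnd w).symm)
    exact congrArg Prod.fst (φ.injective h')
  have hcomm : ∀ v, f (M *ᵥ v) = (φ t).2 • M' *ᵥ f v := fun v => by
    change (φ (i (M *ᵥ v))).1 = _
    rw [← hbr, LieEquiv.map_lie, ExpandedAlgebra.bracket_fst, hsnd, zero_smul, sub_zero]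
    rfl
  refine ⟨LinearMap.toMatrix' f, (φ t).2, ?_, fun hc => hM0 ?_, ?_⟩
  · rw [LinearMap.det_toMatrix']
    exact (LinearEquiv.isUnit_det' (LinearEquiv.ofInjectiveEndo f hinj)).ne_zero
  -- If `c` were zero, then `f (M v) = 0` for all `v`, and injectivity of `f` would give `M = 0`.
  · ext j k
    have h0 : M *ᵥ Pi.single k 1 = 0 := by
      apply hinj
      rw [hcomm, hc, zero_smul, map_zero]
    simpa using congrFun h0 j
  · apply Matrix.toLin'.injective
    refine LinearMap.ext fun v => ?_
    simp only [toLin'_mul, LinearMap.comp_apply, toLin'_toMatrix', toLin'_apply, map_smul,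
      LinearMap.smul_apply, hcomm]

end ExpandedIso

/-! ### Jordan data as an invariant of the operator -/

section JordanChains

open Module Matrix

variable {ι : Type*} [Fintype ι] [DecidableEq ι]

/-- The combinatorial data of a matrix in Jordan form: the eigenvalue `μ i` of the `i`-th basis
vector, its height `h i` in its Jordan chain, and the next basis vector of the chain, if any. -/
structure IsJordanData (μ : ι → ℂ) (h : ι → ℕ) (next : ι → Option ι) : Prop where
  height_next : ∀ i j, next i = some j → h j = h i + 1
  eigenvalue_next : ∀ i j, next i = some j → μ j = μ i
  exists_prev : ∀ j, 1 < h j → ∃ i, next i = some j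
  height_pos : ∀ i, 0 < h i

/-- The matrix in Jordan form with the given data. -/
def jordanMatrix (μ : ι → ℂ) (next : ι → Option ι) : Matrix ι ι ℂ :=
  Matrix.of fun i j => (if i = j then μ i else 0) + if next i = some j then 1 else 0

theorem jordanMatrix_sub_mulVec (μ : ι → ℂ) (next : ι → Option ι) (z : ℂ) (v : ι → ℂ) (i : ι) :
    ((jordanMatrix μ next).toLin' - z • (1 : (ι → ℂ) →ₗ[ℂ] (ι → ℂ))) v i =
      (μ i - z) * v i + (next i).elim 0 v := by
  have h2 : ∑ x, (if next i = some x then v x else 0) = (next i).elim 0 v := by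
    cases next i with
    | none => simp
    | some j => simp
  simp [jordanMatrix, mulVec, dotProduct, add_mul, Finset.sum_add_distrib, h2]
  ring

/-- The kernel is a coordinate subspace: `J - z` lowers height by one along chains with eigenvalue
`z` and is invertible on the other chains. -/
theorem IsJordanData.mem_ker_pow_iff {μ : ι → ℂ} {h : ι → ℕ} {next : ι → Option ι}
    (hJ : IsJordanData μ h next) (z : ℂ) (k : ℕ) (v : ι → ℂ) :
    v ∈ LinearMap.ker (((jordanMatrix μ next).toLin' - z • 1) ^ k) ↔
      ∀ j, ¬(μ j = z ∧ h j ≤ k) → v j = 0 := by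
  induction k generalizing v with
  | zero =>
    have hh : ∀ j, ¬(μ j = z ∧ h j ≤ 0) := fun j hj => by
      have := hJ.height_pos j
      omega
    simp only [pow_zero, LinearMap.mem_ker, Module.End.one_apply, funext_iff, Pi.zero_apply, hh,
      not_false_eq_true, forall_const]
  | succ k ih =>
    rw [LinearMap.mem_ker, pow_succ, Module.End.mul_apply, ← LinearMap.mem_ker, ih]
    simp only [jordanMatrix_sub_mulVec]
    constructor
    · intro hv
      obtain ⟨H, hH⟩ : ∃ H, ∀ j, h j ≤ H :=
        ⟨Finset.univ.sup h, fun j => Finset.le_sup (Finset.mem_univ j)⟩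
      -- Eigenvalues other than `z`: induction down the chain from its last vector, where the
      -- equation reads `(μ j - z) * v j = 0`.
      have hne : ∀ d j, H - h j ≤ d → μ j ≠ z → v j = 0 := by
        intro d
        induction d with
        | zero =>
          intro j hd hj
          have h1 := hv j fun h' => hj h'.1
          cases hn : next j with
          | none =>
            rw [hn] at h1
            simpa [sub_eq_zero, hj] using h1
          | some l =>
            have := hJ.height_next j l hn
            have := hH l
            omega
        | succ d ihd =>
          intro j hd hj
          have h1 := hv j fun h' => hj h'.1
          cases hn : next j with
          | none =>
            rw [hn] at h1
            simpa [sub_eq_zero, hj] using h1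
          | some l =>
            have h2 := hJ.height_next j l hn
            have h3 := ihd l (by omega) (by rwa [hJ.eigenvalue_next j l hn])
            rw [hn] at h1
            simpa [sub_eq_zero, hj, h3] using h1
      intro j hj
      by_cases hz : μ j = z
      -- For eigenvalue `z` the equation at the predecessor `i`, whose height still exceeds `k`,
      -- reads `v j = 0`.
      · have hhj : ¬ h j ≤ k + 1 := fun h' => hj ⟨hz, h'⟩
        obtain ⟨i, hi⟩ := hJ.exists_prev j (by omega)
        have h1 := hJ.height_next i j hi
        have h2 := hv i fun h' => by omega
        rw [hi, ← hJ.eigenvalue_next i j hi, hz] at h2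
        simpa using h2
      · exact hne _ j le_rfl hz
    · intro hv j hj
      have h1 : (μ j - z) * v j = 0 := by
        by_cases hz : μ j = z
        · simp [hz]
        · rw [hv j fun h' => hz h'.1, mul_zero]
      rw [h1, zero_add]
      cases hn : next j with
      | none => rfl
      | some l =>
        refine hv l fun h' => hj ⟨?_, ?_⟩
        · rw [← hJ.eigenvalue_next j l hn, h'.1]
        · have := hJ.height_next j l hn
          omega

theorem finrank_of_mem_iff_support {κ : Type*} [Fintype κ] {S : κ → Prop} [DecidablePred S]
    {W : Submodule ℂ (κ → ℂ)}
    (hW : ∀ v, v ∈ W ↔ ∀ j, ¬ S j → v j = 0) :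
    finrank ℂ W = (Finset.univ.filter S).card := by
  let e : W ≃ₗ[ℂ] ({j // S j} → ℂ) :=
    LinearEquiv.ofBijective ((LinearMap.funLeft ℂ ℂ Subtype.val) ∘ₗ W.subtype) <| by
      constructor
      · intro v w h
        ext j
        by_cases hj : S j
        · exact congrFun h ⟨j, hj⟩
        · rw [(hW v).1 v.2 j hj, (hW w).1 w.2 j hj]
      · intro u
        refine ⟨⟨fun j => if hj : S j then u ⟨j, hj⟩ else 0, (hW _).2 fun j hj => dif_neg hj⟩, ?_⟩
        ext j
        simp [LinearMap.funLeft, j.2]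
  rw [e.finrank_eq, finrank_fintype_fun_eq_card, Fintype.card_subtype]

theorem HasMatrix.exists_conj_toLin' {K V : Type*} [Field K] [AddCommGroup V] [Module K V]
    {T : V →ₗ[K] V} {M : Matrix ι ι K} (h : HasMatrix T M) :
    ∃ e : V ≃ₗ[K] (ι → K), M.toLin' = e.conj T := by
  obtain ⟨b, hb⟩ := h
  refine ⟨b.equivFun, LinearMap.pi_ext' fun j => LinearMap.ext_ring ?_⟩
  have h1 : b.equivFun.symm (Pi.single j 1) = b j := by simp
  simp only [LinearMap.comp_apply, LinearMap.coe_single, LinearEquiv.conj_apply_apply, h1, hb,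
    map_sum, map_smul, toLin'_apply, mulVec_single_one]
  ext i
  simp [Finsupp.single_apply]

theorem HasMatrix.finrank_ker_pow {V : Type*} [AddCommGroup V] [Module ℂ V]
    {T : V →ₗ[ℂ] V} {μ : ι → ℂ} {h : ι → ℕ} {next : ι → Option ι}
    (hT : HasMatrix T (jordanMatrix μ next)) (hJ : IsJordanData μ h next) (z : ℂ) (k : ℕ) :
    finrank ℂ (LinearMap.ker ((T - z • 1) ^ k)) =
      (Finset.univ.filter fun i => μ i = z ∧ h i ≤ k).card := by
  obtain ⟨e, he⟩ := hT.exists_conj_toLin'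
  rw [← finrank_of_mem_iff_support (hJ.mem_ker_pow_iff z k)]
  have hpow : ((jordanMatrix μ next).toLin' - z • 1) ^ k = e.conj ((T - z • 1) ^ k) := by
    rw [he]
    have h1 : e.conj T - z • 1 = e.conj (T - z • 1) := by
      refine LinearMap.ext fun v => ?_
      simp [LinearEquiv.conj_apply_apply]
    rw [h1]
    exact (map_pow e.conjRingEquiv (T - z • 1) k).symm
  rw [hpow]
  have : Submodule.map e.toLinearMap (LinearMap.ker ((T - z • 1) ^ k)) =
    LinearMap.ker (e.conj ((T - z • 1) ^ k)) := by
    ext v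
    simp only [Submodule.mem_map, LinearMap.mem_ker, LinearEquiv.conj_apply_apply]
    constructor
    · rintro ⟨w, hw, rfl⟩
      simp [hw]
    · intro hv
      exact ⟨e.symm v, by simpa using hv, by simp⟩
  rw [← this]
  exact LinearEquiv.finrank_eq (e.submoduleMap _)

/-- The multiset of eigenvalues and heights of the vectors of a Jordan basis. -/
def jordanMultiset (μ : ι → ℂ) (h : ι → ℕ) : Multiset (ℂ × ℕ) :=
  Finset.univ.val.map fun i => (μ i, h i)

/-- The Jordan data is determined by the operator, and scales with it. -/
theorem jordanMultiset_smul {V : Type*} [AddCommGroup V] [Module ℂ V] {T : V →ₗ[ℂ] V}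
    {κ : Type*} [Fintype κ] [DecidableEq κ] {μ : ι → ℂ} {h : ι → ℕ} {next : ι → Option ι}
    {μ' : κ → ℂ} {h' : κ → ℕ} {next' : κ → Option κ} {c : ℂ} (hc : c ≠ 0)
    (hT : HasMatrix T (jordanMatrix μ next)) (hJ : IsJordanData μ h next)
    (hT' : HasMatrix (c • T) (jordanMatrix μ' next')) (hJ' : IsJordanData μ' h' next') :
    jordanMultiset μ' h' = (jordanMultiset μ h).map fun x => (c * x.1, x.2) := by
  -- Both sides are the dimension of `ker (c T - z)^k = ker (T - c⁻¹ z)^k`.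
  have hker : ∀ z k, (Finset.univ.filter fun i => μ' i = z ∧ h' i ≤ k).card =
      (Finset.univ.filter fun i => c * μ i = z ∧ h i ≤ k).card := by
    intro z k
    have h1 := hT'.finrank_ker_pow hJ' z k
    have h2 := hT.finrank_ker_pow hJ (c⁻¹ * z) k
    have h3 : (c • T - z • 1) ^ k = c ^ k • (T - (c⁻¹ * z) • 1) ^ k := by
      rw [← smul_pow, smul_sub, smul_smul, mul_inv_cancel_left₀ hc]
    rw [h3, LinearMap.ker_smul _ _ (pow_ne_zero k hc), h2] at h1
    rw [← h1]
    simp only [eq_inv_mul_iff_mul_eq₀ hc]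
  rw [jordanMultiset, jordanMultiset, Multiset.map_map]
  ext ⟨z, k⟩
  simp only [Multiset.count_map, Function.comp_apply, Prod.mk.injEq]
  change (Finset.univ.filter fun i => z = μ' i ∧ k = h' i).card =
    (Finset.univ.filter fun i => z = c * μ i ∧ k = h i).card
  cases k with
  | zero =>
    rw [Finset.card_eq_zero.2, Finset.card_eq_zero.2]
    · exact Finset.filter_eq_empty_iff.2 fun i _ hi => (hJ.height_pos i).ne hi.2
    · exact Finset.filter_eq_empty_iff.2 fun i _ hi => (hJ'.height_pos i).ne hi.2
  | succ k =>
    -- The number of vectors of height exactly `k + 1` is the difference of the counts for heights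
    -- at most `k + 1` and at most `k`.
    have h1 := hker z k
    have h2 := hker z (k + 1)
    have h3 : (Finset.univ.filter fun i => μ' i = z ∧ h' i ≤ k + 1).card =
        (Finset.univ.filter fun i => μ' i = z ∧ h' i ≤ k).card +
        (Finset.univ.filter fun i => z = μ' i ∧ k + 1 = h' i).card := by
      rw [← Finset.card_union_of_disjoint]
      · congr 1
        ext i
        simp
        grind
      · rw [Finset.disjoint_filter]
        intro i _ hi hi'
        omega
    have h4 : (Finset.univ.filter fun i => c * μ i = z ∧ h i ≤ k + 1).card =
        (Finset.univ.filter fun i => c * μ i = z ∧ h i ≤ k).card +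
        (Finset.univ.filter fun i => z = c * μ i ∧ k + 1 = h i).card := by
      rw [← Finset.card_union_of_disjoint]
      · congr 1
        ext i
        simp
        grind
      · rw [Finset.disjoint_filter]
        intro i _ hi hi'
        omega
    omega

end JordanChains

/-! ### Complex Jordan data of the normal forms -/

namespace NormalForm

open Module Matrix Complex

/-- The eigenvalues of the vectors of a complex Jordan basis. -/
noncomputable def eigenvalue : NormalForm → Fin 4 → ℂ
  | type1 x₁ x₂ x₃ => ![x₁, x₂, x₃, 1]
  | type2 y₁ y₂ => ![y₁, y₂, 1, 1]
  | type3 y₁ y₂ β => ![y₁, y₂, 1 + β * I, 1 - β * I]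
  | type4 y₁ => ![y₁, 1, 1, 1]
  | type5 y₁ => ![y₁, y₁, 1, 1]
  | type6 y₁ β => ![y₁, y₁, 1 + β * I, 1 - β * I]
  | type7 α β β' => ![α + β * I, α - β * I, 1 + β' * I, 1 - β' * I]
  | type8 => ![1, 1, 1, 1]
  | type9 β => ![1 + β * I, 1 - β * I, 1 + β * I, 1 - β * I]

/-- The heights of the vectors of a complex Jordan basis. -/
def height : NormalForm → Fin 4 → ℕ
  | type1 _ _ _ => ![1, 1, 1, 1]
  | type2 _ _ => ![1, 1, 1, 2]
  | type3 _ _ _ => ![1, 1, 1, 1]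
  | type4 _ => ![1, 1, 2, 3]
  | type5 _ => ![1, 2, 1, 2]
  | type6 _ _ => ![1, 2, 1, 1]
  | type7 _ _ _ => ![1, 1, 1, 1]
  | type8 => ![1, 2, 3, 4]
  | type9 _ => ![1, 1, 2, 2]

/-- The next vectors in the chains of a complex Jordan basis. -/
def next : NormalForm → Fin 4 → Option (Fin 4)
  | type1 _ _ _ => ![none, none, none, none]
  | type2 _ _ => ![none, none, some 3, none]
  | type3 _ _ _ => ![none, none, none, none]
  | type4 _ => ![none, some 2, some 3, none]
  | type5 _ => ![some 1, none, some 3, none]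
  | type6 _ _ => ![some 1, none, none, none]
  | type7 _ _ _ => ![none, none, none, none]
  | type8 => ![some 1, some 2, some 3, none]
  | type9 _ => ![some 2, some 3, none, none]

theorem isJordanData (p : NormalForm) : IsJordanData p.eigenvalue p.height p.next := by
  cases p <;>
  · constructor <;> simp [eigenvalue, height, next, Fin.forall_fin_succ, Fin.exists_fin_succ]

/-- Over `ℂ` a rotation block on `u, w` is diagonalized by `u - i w` and `u + i w`. In `type9` both
planes use these vectors, so the identity block between the planes links them into two chains of
length two. -/
theorem hasMatrix_jordanMatrix {V : Type*} [AddCommGroup V] [Module ℂ V] {T : V →ₗ[ℂ] V}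
    (p : NormalForm) (h : HasMatrix T (p.matrix.map ofReal)) :
    HasMatrix T (jordanMatrix p.eigenvalue p.next) := by
  have hI : I ^ 2 = -1 := I_sq
  rcases p with _ | _ | ⟨y₁, y₂, β⟩ | _ | _ | ⟨y₁, β⟩ | ⟨α, β, β'⟩ | _ | β
  case type1 | type2 | type4 | type5 | type8 =>
    convert! h using 1
    ext i j
    fin_cases i <;> fin_cases j <;> simp [jordanMatrix, eigenvalue, next, matrix]
  case type3 | type6 =>
    refine h.conj !![1, 0, 0, 0; 0, 1, 0, 0; 0, 0, 1, 1; 0, 0, -I, I] ?_ ?_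
    · simp [det_succ_row_zero, Fin.sum_univ_succ, Fin.succAbove]
    · ext i j
      fin_cases i <;> fin_cases j <;>
        simp [mul_apply, Fin.sum_univ_succ, jordanMatrix, eigenvalue, next, matrix] <;>
        ring_nf <;> simp [hI]
  case type7 | type9 =>
    refine h.conj !![1, 1, 0, 0; -I, I, 0, 0; 0, 0, 1, 1; 0, 0, -I, I] ?_ ?_
    · simp [det_succ_row_zero, Fin.sum_univ_succ, Fin.succAbove]
    · ext i j
      fin_cases i <;> fin_cases j <;>
        simp [mul_apply, Fin.sum_univ_succ, jordanMatrix, eigenvalue, next, matrix] <;>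
        ring_nf <;> simp [hI]

theorem det_matrix_ne_zero {p : NormalForm} (hp : p.Admissible) : p.matrix.det ≠ 0 := by
  rcases p with ⟨x₁, x₂, x₃⟩ | ⟨y₁, y₂⟩ | ⟨y₁, y₂, β⟩ | y₁ | y₁ | ⟨y₁, β⟩ | ⟨α, β, β'⟩ | _ | β <;>
    simp only [Admissible] at hp
  case type1 =>
    have : 0 < x₁ * x₂ * x₃ := mul_pos (mul_pos (by linarith) (by linarith)) (by linarith)
    convert! this.ne' using 1
    simp [matrix, det_succ_row_zero, Fin.sum_univ_succ, Fin.succAbove]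
    ring
  case type2 =>
    have : 0 < y₁ * y₂ := mul_pos (by linarith) (by linarith)
    convert! this.ne' using 1
    simp [matrix, det_succ_row_zero, Fin.sum_univ_succ, Fin.succAbove]
  case type3 =>
    have : 0 < y₁ * y₂ * (1 + β ^ 2) :=
      mul_pos (mul_pos (by linarith) (by linarith)) (by positivity)
    convert! this.ne' using 1
    simp [matrix, det_succ_row_zero, Fin.sum_univ_succ, Fin.succAbove]
    ring
  case type4 =>
    convert! hp.ne' using 1
    simp [matrix, det_succ_row_zero, Fin.sum_univ_succ, Fin.succAbove]
  case type5 =>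
    have : 0 < y₁ ^ 2 := pow_pos hp.1 2
    convert! this.ne' using 1
    simp [matrix, det_succ_row_zero, Fin.sum_univ_succ, Fin.succAbove]
    ring
  case type6 =>
    have : 0 < y₁ ^ 2 * (1 + β ^ 2) := mul_pos (pow_pos hp.1 2) (by positivity)
    convert! this.ne' using 1
    simp [matrix, det_succ_row_zero, Fin.sum_univ_succ, Fin.succAbove]
    ring
  case type7 =>
    have : 0 < (α ^ 2 + β ^ 2) * (1 + β' ^ 2) :=
      mul_pos (add_pos (pow_pos hp.1 2) (pow_pos hp.2.2.1 2)) (by positivity)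
    convert! this.ne' using 1
    simp [matrix, det_succ_row_zero, Fin.sum_univ_succ, Fin.succAbove]
    ring
  case type8 =>
    simp [matrix, det_succ_row_zero, Fin.sum_univ_succ, Fin.succAbove]
  case type9 =>
    have : 0 < (1 + β ^ 2) ^ 2 := by positivity
    convert! this.ne' using 1
    simp [matrix, det_succ_row_zero, Fin.sum_univ_succ, Fin.succAbove]
    ring

/-- The multiset of eigenvalues and heights of the vectors of a complex Jordan basis. -/
noncomputable def jordan (p : NormalForm) : Multiset (ℂ × ℕ) :=
  jordanMultiset p.eigenvalue p.height

theorem exists_jordan_eq_smul {p q : NormalForm} (hq : q.Admissible)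
    (φ : ExpandedAlgebra p.matrix ≃ₗ⁅ℝ⁆ ExpandedAlgebra q.matrix) :
    ∃ c : ℝ, c ≠ 0 ∧ q.jordan = p.jordan.map fun x => ((c : ℂ) * x.1, x.2) := by
  -- The inverse isomorphism is used so that the scalar multiplies the matrix of `p`.
  obtain ⟨P, c, hP, hc, hPM⟩ :=
    ExpandedAlgebra.exists_similar_of_equiv (det_matrix_ne_zero hq) φ.symm
  have hT : HasMatrix (p.matrix.map ofReal).toLin' (p.matrix.map ofReal) := by
    refine ⟨Pi.basisFun ℂ (Fin 4), fun j => ?_⟩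
    ext i
    simp [Finset.sum_apply, Pi.single_apply]
  have hT' : HasMatrix ((c : ℂ) • (p.matrix.map ofReal).toLin') (q.matrix.map ofReal) := by
    refine (hT.smul (c : ℂ)).conj (P.map ofReal) ?_ ?_
    · have := (RingHom.map_det ofRealHom P).symm
      rw [RingHom.mapMatrix_apply] at this
      erw [this]
      simpa using hP
    · ext i j
      have h1 := congrFun (congrFun hPM i) j
      simp only [mul_apply, Matrix.smul_apply, map_apply, smul_eq_mul] at h1 ⊢
      exact_mod_cast h1.symm
  exact ⟨c, hc, jordanMultiset_smul (by exact_mod_cast hc) (p.hasMatrix_jordanMatrix hT)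
    p.isJordanData (q.hasMatrix_jordanMatrix hT') q.isJordanData⟩

end NormalForm

/-! ### Recovering the normal form from its Jordan data -/

namespace NormalForm

open Complex

/-- The heights in a Jordan basis, together with the reality of the eigenvalues. -/
def kind : NormalForm → Multiset (ℕ × Bool)
  | type1 _ _ _ => {(1, true), (1, true), (1, true), (1, true)}
  | type2 _ _ => {(1, true), (1, true), (1, true), (2, true)}
  | type3 _ _ _ => {(1, true), (1, true), (1, false), (1, false)}
  | type4 _ => {(1, true), (1, true), (2, true), (3, true)}
  | type5 _ => {(1, true), (2, true), (1, true), (2, true)}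
  | type6 _ _ => {(1, true), (2, true), (1, false), (1, false)}
  | type7 _ _ _ => {(1, false), (1, false), (1, false), (1, false)}
  | type8 => {(1, true), (2, true), (3, true), (4, true)}
  | type9 _ => {(1, false), (1, false), (2, false), (2, false)}

/-- The eigenvalues and heights of a Jordan basis as a list. -/
noncomputable def jordanList (p : NormalForm) : List (ℂ × ℕ) :=
  List.ofFn fun i => (p.eigenvalue i, p.height i)

theorem jordan_eq_coe (p : NormalForm) : p.jordan = p.jordanList := by
  rw [jordan, jordanMultiset, Fin.univ_val_map, jordanList]

/-- This invariant is unchanged by nonzero real scaling and takes nine different values, so it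
separates the types. -/
theorem map_jordan_eq_kind {p : NormalForm} (hp : p.Admissible) :
    p.jordan.map (fun x => (x.2, decide (x.1.im = 0))) = p.kind := by
  rw [jordan_eq_coe]
  cases p <;> simp only [Admissible] at hp <;>
    simp [jordanList, eigenvalue, height, kind, List.ofFn_succ]
  case type3 => simp [hp.2.2.ne']; rfl
  case type6 => simp [hp.2.ne']; rfl
  case type7 => simp [hp.2.2.1.ne', hp.2.2.2.1.ne']; rfl
  case type9 => simp [hp.ne']; rfl
  all_goals rfl

theorem re_pos_of_mem_jordan {p : NormalForm} (hp : p.Admissible) :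
    ∀ x ∈ p.jordan, 0 < x.1.re := by
  rw [jordan_eq_coe]
  cases p <;> simp only [Admissible] at hp <;>
    simp [jordanList, eigenvalue, height, List.ofFn_succ]
  case type1 => exact ⟨by linarith, by linarith, by linarith⟩
  case type2 => exact ⟨by linarith, by linarith⟩
  case type3 => exact ⟨by linarith, by linarith⟩
  case type4 => exact hp
  case type5 => exact hp.1
  case type6 => exact hp.1
  case type7 => exact hp.1

theorem eq_of_perm_pair {a b a' b' : ℝ} (h : [a, b].Perm [a', b']) (hab : a ≤ b)
    (hab' : a' ≤ b') : a = a' ∧ b = b' := by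
  have := List.Perm.eq_of_pairwise' (r := (· ≤ ·)) (by simpa) (by simpa) h
  simpa using this

theorem eq_of_jordan_eq_smul {p q : NormalForm} (hp : p.Admissible) (hq : q.Admissible) {c : ℝ}
    (hc : c ≠ 0) (h : q.jordan = p.jordan.map fun x => ((c : ℂ) * x.1, x.2)) : p = q := by
  have hkind : p.kind = q.kind := by
    rw [← map_jordan_eq_kind hp, ← map_jordan_eq_kind hq, h, Multiset.map_map]
    simp [hc]
  have hperm : q.jordanList.Perm (p.jordanList.map fun x => ((c : ℂ) * x.1, x.2)) := by
    rw [jordan_eq_coe, jordan_eq_coe] at h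
    simpa using h
  -- Some eigenvalue and its multiple by `c` both have positive real part.
  have hcpos : 0 < c := by
    have h0 : (p.eigenvalue 0, p.height 0) ∈ p.jordanList := List.mem_ofFn.2 ⟨0, rfl⟩
    have h1 := re_pos_of_mem_jordan hp _ (by rw [jordan_eq_coe]; exact h0)
    have h2 := re_pos_of_mem_jordan hq ((c : ℂ) * p.eigenvalue 0, p.height 0) (by
      rw [jordan_eq_coe]
      exact hperm.mem_iff.2 (List.mem_map.2 ⟨_, h0, rfl⟩))
    simp only [re_ofReal_mul] at h1 h2
    exact pos_of_mul_pos_left h2 h1.le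
  -- The parameters are read off by selecting part of the Jordan data and projecting it to real
  -- numbers.
  have hmap : ∀ (P : ℂ × ℕ → Bool) (f : ℂ × ℕ → ℝ), ((q.jordanList.filter P).map f).Perm
      (((p.jordanList.map fun x => ((c : ℂ) * x.1, x.2)).filter P).map f) :=
    fun P f => (hperm.filter P).map f
  rcases p with ⟨x₁, x₂, x₃⟩ | ⟨y₁, y₂⟩ | ⟨y₁, y₂, β⟩ | y₁ | y₁ | ⟨y₁, β⟩ | ⟨α, β, β'⟩ | _ | β <;>
  rcases q with ⟨u₁, u₂, u₃⟩ | ⟨v₁, v₂⟩ | ⟨v₁, v₂, δ⟩ | v₁ | v₁ | ⟨v₁, δ⟩ | ⟨γ, δ, δ'⟩ | _ | δ <;>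
  first
  | (exfalso; revert hkind; simp only [kind]; decide)
  | skip
  all_goals
    clear hkind h
    simp only [Admissible] at hp hq
    simp only [jordanList, eigenvalue, height, List.ofFn_succ, List.ofFn_zero] at hperm hmap
    simp at hperm hmap
  case type1.type1 =>
    -- Both lists of eigenvalues are increasing, hence equal; their last entries give `1 = c`.
    have h1 := hmap (fun _ => true) fun x => x.1.re
    simp at h1
    have := List.Perm.eq_of_pairwise' (r := (· ≤ ·))
      (by simp only [List.pairwise_cons]; simp; grind)
      (by
        have h2 := mul_le_mul_of_nonneg_left hp.2.1 hcpos.le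
        have h3 := mul_le_mul_of_nonneg_left hp.2.2.1 hcpos.le
        have h4 := mul_le_mul_of_nonneg_left hp.2.2.2 hcpos.le
        simp only [List.pairwise_cons]
        simp
        grind) h1
    simp only [List.cons.injEq] at this
    obtain ⟨h2, h3, h4, rfl, -⟩ := this
    simp only [one_mul] at h2 h3 h4
    rw [h2, h3, h4]
  case type2.type2 =>
    -- The only vector of height two has eigenvalue `1`, so `c = 1`.
    have h1 := hmap (fun x => x.2 = 2) fun x => x.1.re
    simp at h1
    subst h1
    have h2 := hmap (fun x => x.2 = 1) fun x => x.1.re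
    simp only [List.filter_cons] at h2
    simp at h2
    have h3 : [v₁, v₂].Perm [y₁, y₂] :=
      (List.perm_append_right_iff [1]).1 (by simpa using h2)
    obtain ⟨rfl, rfl⟩ := eq_of_perm_pair h3 hq.2 hp.2
    rfl
  case type3.type3 =>
    -- The nonreal eigenvalue `1 + δ i` must equal `c (1 ± β i)`; real parts give `c = 1`, and
    -- positivity of `β` and `δ` fixes the sign.
    have h1 : ((1 + δ * I : ℂ), 1) ∈
        [((v₁ : ℂ), 1), (↑v₂, 1), (1 + ↑δ * I, 1), (1 - ↑δ * I, 1)] := by simp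
    rw [hperm.mem_iff] at h1
    simp [Complex.ext_iff, hq.2.2.ne'] at h1
    obtain rfl : 1 = c := h1.elim And.left And.left
    have h2 : β = δ := by grind
    have h3 := hmap (fun x => x.1.im = 0) fun x => x.1.re
    simp [hp.2.2.ne', hq.2.2.ne'] at h3
    obtain ⟨rfl, rfl⟩ := eq_of_perm_pair h3 hq.2.1 hp.2.1
    rw [h2]
  case type4.type4 =>
    have h1 := hmap (fun x => x.2 = 2) fun x => x.1.re
    simp at h1
    subst h1
    have h2 := hmap (fun x => x.2 = 1) fun x => x.1.re
    simp only [List.filter_cons] at h2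
    simp at h2
    have h3 : [v₁].Perm [y₁] := (List.perm_append_right_iff [1]).1 (by simpa using h2)
    simp at h3
    rw [h3]
  case type5.type5 =>
    have h1 := hmap (fun x => x.2 = 1) fun x => x.1.re
    simp only [List.filter_cons] at h1
    simp at h1
    obtain ⟨h2, rfl⟩ := eq_of_perm_pair h1 hq.2 (mul_le_of_le_one_right hcpos.le hp.2)
    rw [h2, one_mul]
  case type6.type6 =>
    have h1 : ((1 + δ * I : ℂ), 1) ∈
        [((v₁ : ℂ), 1), (↑v₁, 2), (1 + ↑δ * I, 1), (1 - ↑δ * I, 1)] := by simp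
    rw [hperm.mem_iff] at h1
    simp [Complex.ext_iff, hq.2.ne'] at h1
    obtain rfl : 1 = c := h1.elim And.left And.left
    have h2 : β = δ := by grind
    have h3 := hmap (fun x => x.2 = 2) fun x => x.1.re
    simp at h3
    rw [h2, h3]
  case type7.type7 =>
    obtain ⟨hα, hα1, hβ, hβ', hββ'⟩ := hp
    obtain ⟨hγ, hγ1, hδ, hδ', hδδ'⟩ := hq
    -- One eigenvalue of each conjugate pair is kept. The larger real part is `1` on one side and
    -- `c` on the other.
    have h1 := hmap (fun x => 0 < x.1.im) fun x => x.1.re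
    simp [hβ, hβ', hδ, hδ', hcpos, hβ.le, hβ'.le, hδ.le, hδ'.le] at h1
    obtain ⟨h2, rfl⟩ := eq_of_perm_pair h1 hγ1 (mul_le_of_le_one_right hcpos.le hα1)
    rw [one_mul] at h2
    subst h2
    have h3 := hmap (fun x => 0 < x.1.im) fun x => x.1.im
    simp [hβ, hβ', hδ, hδ', hβ.le, hβ'.le, hδ.le, hδ'.le] at h3
    by_cases h4 : γ = 1
    · obtain ⟨rfl, rfl⟩ := eq_of_perm_pair h3 (hδδ' h4) (hββ' h4)
      rfl
    -- When the real parts differ, the eigenvalue with real part `1` identifies the second block.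
    · have h5 := hmap (fun x => 0 < x.1.im ∧ x.1.re = 1) fun x => x.1.im
      simp [hβ, hβ', hδ, hδ', hβ'.le, hδ'.le, h4] at h5
      subst h5
      have h6 : [δ].Perm [β] := (List.perm_append_right_iff [δ']).1 (by simpa using h3)
      simp at h6
      rw [h6]
  case type8.type8 => rfl
  case type9.type9 =>
    have h1 : ((1 + δ * I : ℂ), 1) ∈ [((1 + δ * I : ℂ), 1), (1 - ↑δ * I, 1), (1 + ↑δ * I, 2),
      (1 - ↑δ * I, 2)] := by simp
    rw [hperm.mem_iff] at h1
    simp [Complex.ext_iff] at h1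
    obtain rfl : 1 = c := h1.elim And.left And.left
    have h2 : β = δ := by grind
    rw [h2]

end NormalForm

/-- That every item defines a Lie algebra is contained in the instances on `ExpandedAlgebra`, which
hold for any matrix. -/
theorem theorem4p2 :
    (∀ (g : Type*) [LieRing g] [LieAlgebra ℝ g],
      Module.finrank ℝ g = 5 → IsSNC g → IsLieAbelian (derivedAlgebra g) →
        Module.finrank ℝ (derivedAlgebra g) = 4 ∧
        ∃ (p : NormalForm) (e : Module.Basis (Fin 4) ℝ (derivedAlgebra g)) (e₅ : g),
          p.Admissible ∧ e₅ ∉ derivedAlgebra g ∧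
          ∀ j : Fin 4, ⁅e₅, (e j : g)⁆ = ∑ i : Fin 4, p.matrix i j • (e i : g)) ∧
    (∀ p q : NormalForm, p.Admissible → q.Admissible → p ≠ q →
      IsEmpty (ExpandedAlgebra p.matrix ≃ₗ⁅ℝ⁆ ExpandedAlgebra q.matrix)) := by
  refine ⟨fun g _ _ hdim hg hab => hg.exists_normalForm hdim hab,
    fun p q hp hq hpq => ⟨fun φ => ?_⟩⟩
  obtain ⟨c, hc, h⟩ := NormalForm.exists_jordan_eq_smul hq φ
  exact hpq (NormalForm.eq_of_jordan_eq_smul hp hq hc h)
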